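/- Let $1\le d\le N$ be integers and let $$S^{N-1,d-1}_{\mathbb R}=\{x\in\mathbb R^N : \textstyle\sum_i x_i^2=1,\ x_{i_0}x_{i_1}\cdots x_{i_d}=0 \text{ for all distinct } i_0,\ldots,i_d\}.$$ A closed quantum subgroup $G\subset O_N^+$ is a compact matrix quantum group in the sense of Woronowicz whose fundamental matrix $u=(u_{ij})$ has self-adjoint entries and is orthogonal. That is, it is given by a nonzero unital $C^*$-algebra $C(G)$ and a matrix $u\in M_N(C(G))$ with $u_{ij}=u_{ij}^*$ and $uu^t=u^tu=1$, such that: the unital $*$-algebra $\mathcal A$ generated by the $u_{ij}$ is dense in $C(G)$; there is a unital $*$-homomorphism $\Delta:C(G)\to C(G)\otimes_{\min}C(G)$ with $\Delta(u_{ij})=\sum_k u_{ik}\otimes u_{kj}$; and there is a linear antimultiplicative map $\kappa:\mathcal A\to\mathcal A$ with $\kappa(\kappa(a^*)^*)=a$ for $a\in\mathcal A$ and $\sum_k\kappa(u_{ik})u_{kj}=\delta_{ij}=\sum_k u_{ik}\kappa(u_{kj})$. We write $H\subset G$ if there is a unital $*$-homomorphism $C(G)\to C(H)$ mapping the coordinates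 $u_{ij}$ of $G$ to those of $H$. For a compact set $X\subset\mathbb R^N$ with coordinate functions $x_1,\ldots,x_N\in C(X)$, we say that $G$ acts affinely on $X$ if there is a unital $*$-homomorphism $\Phi:C(X)\to C(G)\otimes C(X)$ with $\Phi(x_i)=\sum_j u_{ij}\otimes x_j$ for all $i$. The quantum isometry group $G^+(X)$ is the universal closed quantum subgroup of $O_N^+$ acting affinely on $X$: it acts affinely on $X$, and every closed quantum subgroup $H\subset O_N^+$ acting affinely on $X$ satisfies $H\subset G^+(X)$. Let $O_N$ be the orthogonal group and $H_N\subset O_N$ the hyperoctahedral group of signed permutation matrices, both viewed as closed quantum subgroups of $O_N^+$ through $C(O_N)$, $C(H_N)$ and the coordinate functions $U\mapsto U_{ij}$. Let $H_N^+$ be the free hyperoctahedral group: $C(H_N^+)$ is the universal unital $C^*$-algebra generated by the entries $u_{ij}=u_{ij}^*$ of an $N\times N$ matrix $u$ subject to $uu^t=u^tu=1$ and to $ab=0$ for any two distinct entries $a,b$ on the same row or the same column of $u$. Then the quantum isometry group of $S^{N-1,d-1}_{\mathbb R}$ is as follows: 1. if $d=1$, then $G^+(S^{N-1,d-1}_{\mathbb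 R})=H_N^+$; 2. if $2\le d\le N-1$, then $G^+(S^{N-1,d-1}_{\mathbb R})=H_N$; 3. if $d=N$, then $G^+(S^{N-1,d-1}_{\mathbb R})=O_N$. In particular, $H_N^+$, $H_N$ and $O_N$ are closed quantum subgroups of $O_N^+$ that act affinely on the respective spheres. -/

import Mathlib

open scoped TensorProduct

universe u v

noncomputable section

namespace PolygonalSphere

/-- A C⋆-seminorm on a complex unital ⋆-algebra. -/
structure CStarSeminorm (F : Type u) [Ring F] [StarRing F] [Algebra ℂ F] extends
    Seminorm ℂ F where
  mul_le' : ∀ x y, toFun (x * y) ≤ toFun x * toFun y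
  star_mul_self' : ∀ x, toFun (star x * x) = toFun x ^ 2

namespace CStarSeminorm

section Basic

variable {F : Type u} [Ring F] [StarRing F] [Algebra ℂ F]

instance : CoeFun (CStarSeminorm F) fun _ => F → ℝ := ⟨fun p => p.toSeminorm⟩

theorem mul_le (p : CStarSeminorm F) (x y : F) : p (x * y) ≤ p x * p y := p.mul_le' x y

theorem star_mul_self (p : CStarSeminorm F) (x : F) : p (star x * x) = p x ^ 2 :=
  p.star_mul_self' x

theorem nonneg (p : CStarSeminorm F) (x : F) : 0 ≤ p x := apply_nonneg p.toSeminorm x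

theorem le_star (p : CStarSeminorm F) (x : F) : p x ≤ p (star x) := by
  by_contra! h
  have h1 := p.mul_le (star x) x
  rw [p.star_mul_self] at h1
  have := p.nonneg (star x)
  nlinarith

theorem apply_star (p : CStarSeminorm F) (x : F) : p (star x) = p x :=
  le_antisymm (by simpa using p.le_star (star x)) (p.le_star x)

/-- The pointwise supremum of a pointwise bounded set of C⋆-seminorms. -/
def sup (P : Set (CStarSeminorm F)) (hP : ∀ x, BddAbove (Set.range fun p : P => p.1 x)) :
    CStarSeminorm F where
  toFun x := ⨆ p : P, p.1 x
  map_zero' := by simp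
  add_le' x y := Real.iSup_le (fun p => (map_add_le_add p.1.toSeminorm x y).trans
    (add_le_add (le_ciSup (hP x) p) (le_ciSup (hP y) p)))
    (add_nonneg (Real.iSup_nonneg fun p => p.1.nonneg x) (Real.iSup_nonneg fun p => p.1.nonneg y))
  neg' x := by simp
  smul' c x := by
    rw [Real.mul_iSup_of_nonneg (norm_nonneg c)]
    exact iSup_congr fun p => map_smul_eq_mul p.1.toSeminorm c x
  mul_le' x y := Real.iSup_le (fun p => (p.1.mul_le x y).trans
    (mul_le_mul (le_ciSup (hP x) p) (le_ciSup (hP y) p) (p.1.nonneg y)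
      (Real.iSup_nonneg fun p => p.1.nonneg x)))
    (mul_nonneg (Real.iSup_nonneg fun p => p.1.nonneg x) (Real.iSup_nonneg fun p => p.1.nonneg y))
  star_mul_self' x := by
    apply le_antisymm
    · refine Real.iSup_le (fun p => ?_) (sq_nonneg _)
      rw [p.1.star_mul_self]
      exact pow_le_pow_left₀ (p.1.nonneg x) (le_ciSup (hP x) p) 2
    · have h0 : 0 ≤ ⨆ p : P, p.1 (star x * x) := Real.iSup_nonneg fun p => p.1.nonneg _
      refine (Real.le_sqrt (Real.iSup_nonneg fun p => p.1.nonneg x) h0).1 ?_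
      refine Real.iSup_le (fun p => ?_) (Real.sqrt_nonneg _)
      refine (Real.le_sqrt (p.1.nonneg x) h0).2 ?_
      rw [← p.1.star_mul_self]
      exact le_ciSup (hP (star x * x)) p

/-- A copy of the ⋆-algebra `F`, topologised by the C⋆-seminorm `p`. -/
def Pre (_ : CStarSeminorm F) : Type u := F

variable (p : CStarSeminorm F)

/-- The identity map from `F` to its topologised copy. -/
def toPre (x : F) : p.Pre := x

instance : Ring p.Pre := inferInstanceAs (Ring F)
instance : StarRing p.Pre := inferInstanceAs (StarRing F)
instance : Algebra ℂ p.Pre := inferInstanceAs (Algebra ℂ F)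
instance [StarModule ℂ F] : StarModule ℂ p.Pre := inferInstanceAs (StarModule ℂ F)

instance : Norm p.Pre := ⟨fun x => p x⟩

instance : SeminormedRing p.Pre where
  toRing := inferInstance
  toNorm := inferInstance
  toPseudoMetricSpace :=
    (p.toSeminorm.toAddGroupSeminorm.toSeminormedAddCommGroup).toPseudoMetricSpace
  dist_eq _ _ := (p.toSeminorm.toAddGroupSeminorm.toSeminormedAddCommGroup).dist_eq _ _
  norm_mul_le := p.mul_le

instance : NormedAlgebra ℂ p.Pre where
  norm_smul_le c x := (map_smul_eq_mul p.toSeminorm c x).le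

instance : NormedStarGroup p.Pre where
  norm_star_le x := (p.apply_star x).le

/-- The (Hausdorff) completion of `F` with respect to the C⋆-seminorm `p`; a C⋆-algebra. -/
def Completion : Type u := UniformSpace.Completion p.Pre

instance : NormedRing p.Completion := inferInstanceAs (NormedRing (UniformSpace.Completion p.Pre))
instance : CompleteSpace p.Completion :=
  inferInstanceAs (CompleteSpace (UniformSpace.Completion p.Pre))
instance : Algebra ℂ p.Completion :=
  inferInstanceAs (Algebra ℂ (UniformSpace.Completion p.Pre))
instance : NormedAlgebra ℂ p.Completion where
  norm_smul_le c x := norm_smul_le (β := UniformSpace.Completion p.Pre) c x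

/-- The canonical map from `F` to its completion. -/
def of (x : F) : p.Completion := ((p.toPre x : p.Pre) : UniformSpace.Completion p.Pre)

theorem norm_of (x : F) : ‖p.of x‖ = p x := UniformSpace.Completion.norm_coe (p.toPre x)

theorem denseRange_of : DenseRange p.of :=
  UniformSpace.Completion.denseRange_coe (α := p.Pre)

theorem of_add (x y : F) : p.of (x + y) = p.of x + p.of y :=
  UniformSpace.Completion.coe_add (p.toPre x) (p.toPre y)

theorem of_mul (x y : F) : p.of (x * y) = p.of x * p.of y :=
  UniformSpace.Completion.coe_mul (p.toPre x) (p.toPre y)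

theorem of_one : p.of 1 = 1 := rfl

theorem of_smul (c : ℂ) (x : F) : p.of (c • x) = c • p.of x :=
  UniformSpace.Completion.coe_smul c (p.toPre x)

instance : Star p.Completion where
  star := UniformSpace.Completion.map (star : p.Pre → p.Pre)

theorem continuous_star : Continuous (star : p.Completion → p.Completion) :=
  UniformSpace.Completion.continuous_map

theorem of_star (x : F) : p.of (star x) = star (p.of x) :=
  (UniformSpace.Completion.map_coe (f := (star : p.Pre → p.Pre))
    star_isometry.uniformContinuous (p.toPre x)).symm

theorem induction {P : p.Completion → Prop} (hc : IsClosed {x | P x}) (h : ∀ x, P (p.of x)) :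
    ∀ x, P x := fun x => p.denseRange_of.induction_on x hc h

instance : StarRing p.Completion where
  star_involutive := p.induction
    (isClosed_eq (p.continuous_star.comp p.continuous_star) continuous_id) fun x => by
      simp [← of_star]
  star_mul x y := by
    have := p.continuous_star
    revert y
    refine p.induction (isClosed_eq (by fun_prop) (by fun_prop)) fun y => ?_
    revert x
    refine p.induction (isClosed_eq (by fun_prop) (by fun_prop)) fun x => ?_
    simp [← of_star, ← of_mul]
  star_add x y := by
    have := p.continuous_star
    revert y
    refine p.induction (isClosed_eq (by fun_prop) (by fun_prop)) fun y => ?_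
    revert x
    refine p.induction (isClosed_eq (by fun_prop) (by fun_prop)) fun x => ?_
    simp [← of_star, ← of_add]

instance [StarModule ℂ F] : CStarAlgebra p.Completion where
  norm_mul_self_le := p.induction
    (isClosed_le (by fun_prop) (continuous_norm.comp (p.continuous_star.mul continuous_id)))
    fun x => by
      rw [← of_star, ← of_mul, norm_of, norm_of, p.star_mul_self, sq]
  star_smul c := p.induction
    (isClosed_eq (p.continuous_star.comp (continuous_const_smul c))
      (continuous_const_smul (star c) |>.comp p.continuous_star)) fun x => by
      rw [← of_smul, ← of_star, ← of_star, star_smul, of_smul]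

/-- The canonical ⋆-homomorphism from `F` to its completion. -/
def ofHom : F →⋆ₐ[ℂ] p.Completion where
  toFun := p.of
  map_one' := p.of_one
  map_mul' := p.of_mul
  map_zero' := by simpa using p.of_smul 0 0
  map_add' := p.of_add
  commutes' c := by simp only [Algebra.algebraMap_eq_smul_one, of_smul, of_one]
  map_star' := p.of_star

end Basic

section Representation

variable {F : Type u} [Ring F] [StarRing F] [Algebra ℂ F]
  {V : Type v} [SeminormedAddCommGroup V] [InnerProductSpace ℂ V]

/-- The operator norm of a ⋆-representation of `F` by bounded operators on a (pre-)Hilbert space,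
as a C⋆-seminorm on `F`. -/
def ofRep (Θ : F →ₐ[ℂ] Module.End ℂ V)
    (hstar : ∀ t x y, inner ℂ (Θ t x) y = inner ℂ x (Θ (star t) y))
    (hbdd : ∀ t, ∃ C, ∀ x, ‖Θ t x‖ ≤ C * ‖x‖) : CStarSeminorm F where
  toFun t := ‖(Θ t).mkContinuousOfExistsBound (hbdd t)‖
  map_zero' := by
    refine le_antisymm (ContinuousLinearMap.opNorm_le_bound _ le_rfl fun x => ?_) (norm_nonneg _)
    simp
  add_le' s t := by
    refine ContinuousLinearMap.opNorm_le_bound _ (by positivity) fun x => ?_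
    have h1 := ((Θ s).mkContinuousOfExistsBound (hbdd s)).le_opNorm x
    have h2 := ((Θ t).mkContinuousOfExistsBound (hbdd t)).le_opNorm x
    simp only [LinearMap.mkContinuousOfExistsBound_apply, map_add, LinearMap.add_apply] at *
    exact (norm_add_le _ _).trans (by linarith)
  neg' t := by
    have : (Θ (-t)).mkContinuousOfExistsBound (hbdd (-t)) =
        -(Θ t).mkContinuousOfExistsBound (hbdd t) := by ext x; simp
    rw [this, norm_neg]
  smul' c t := by
    have : (Θ (c • t)).mkContinuousOfExistsBound (hbdd (c • t)) =
        c • (Θ t).mkContinuousOfExistsBound (hbdd t) := by ext x; simp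
    rw [this, norm_smul]
  mul_le' s t := by
    have : (Θ (s * t)).mkContinuousOfExistsBound (hbdd (s * t)) =
        (Θ s).mkContinuousOfExistsBound (hbdd s) ∘L
          (Θ t).mkContinuousOfExistsBound (hbdd t) := by ext x; simp
    rw [this]
    exact ContinuousLinearMap.opNorm_comp_le _ _
  star_mul_self' t := by
    have key : ∀ t, ‖(Θ t).mkContinuousOfExistsBound (hbdd t)‖ ^ 2 ≤
        ‖(Θ (star t * t)).mkContinuousOfExistsBound (hbdd (star t * t))‖ := fun t => by
      refine (Real.le_sqrt (norm_nonneg _) (norm_nonneg _)).1 ?_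
      refine ContinuousLinearMap.opNorm_le_bound _ (Real.sqrt_nonneg _) fun x => ?_
      rw [← Real.sqrt_sq (norm_nonneg x), ← Real.sqrt_mul (norm_nonneg _)]
      refine Real.le_sqrt_of_sq_le ?_
      simp only [LinearMap.mkContinuousOfExistsBound_apply]
      rw [← inner_self_eq_norm_sq (𝕜 := ℂ), hstar, ← Module.End.mul_apply, ← map_mul]
      have h1 := ((Θ (star t * t)).mkContinuousOfExistsBound (hbdd (star t * t))).le_opNorm x
      simp only [LinearMap.mkContinuousOfExistsBound_apply] at h1
      refine (re_inner_le_norm _ _).trans ?_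
      nlinarith [norm_nonneg x]
    have hmul : ∀ s t, ‖(Θ (s * t)).mkContinuousOfExistsBound (hbdd (s * t))‖ ≤
        ‖(Θ s).mkContinuousOfExistsBound (hbdd s)‖ *
          ‖(Θ t).mkContinuousOfExistsBound (hbdd t)‖ := fun s t => by
      have : (Θ (s * t)).mkContinuousOfExistsBound (hbdd (s * t)) =
          (Θ s).mkContinuousOfExistsBound (hbdd s) ∘L
            (Θ t).mkContinuousOfExistsBound (hbdd t) := by ext x; simp
      rw [this]
      exact ContinuousLinearMap.opNorm_comp_le _ _
    refine le_antisymm ?_ (key t)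
    have h1 := key (star t)
    rw [star_star] at h1
    have h2 := hmul (star t) t
    have h3 := hmul t (star t)
    set a := ‖(Θ t).mkContinuousOfExistsBound (hbdd t)‖
    set b := ‖(Θ (star t)).mkContinuousOfExistsBound (hbdd (star t))‖
    have hb : b ≤ a := by
      by_contra! h
      have : 0 ≤ a := norm_nonneg _
      nlinarith
    have : 0 ≤ a := norm_nonneg _
    nlinarith

theorem ofRep_apply_le {Θ : F →ₐ[ℂ] Module.End ℂ V}
    {hstar : ∀ t x y, inner ℂ (Θ t x) y = inner ℂ x (Θ (star t) y)}
    {hbdd : ∀ t, ∃ C, ∀ x, ‖Θ t x‖ ≤ C * ‖x‖} {t : F} {C : ℝ} (hC : 0 ≤ C)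
    (h : ∀ x, ‖Θ t x‖ ≤ C * ‖x‖) : ofRep Θ hstar hbdd t ≤ C :=
  ContinuousLinearMap.opNorm_le_bound _ hC h

end Representation

end CStarSeminorm

section Tensor

variable {A : Type u} {B : Type v} [CStarAlgebra A] [CStarAlgebra B]

/-- A ⋆-representation of a C⋆-algebra on a pre-Hilbert space is contractive. -/
theorem norm_rep_le {V : Type*} [SeminormedAddCommGroup V] [InnerProductSpace ℂ V]
    (Θ : A →ₐ[ℂ] Module.End ℂ V)
    (hstar : ∀ t x y, inner ℂ (Θ t x) y = inner ℂ x (Θ (star t) y)) (a : A) (x : V) :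
    ‖Θ a x‖ ≤ ‖a‖ * ‖x‖ := by
  let := CStarAlgebra.spectralOrder A
  let := CStarAlgebra.spectralOrderedRing A
  have h : (0 : A) ≤ algebraMap ℝ A (‖a‖ ^ 2) - star a * a :=
    sub_nonneg.2 CStarAlgebra.star_mul_le_algebraMap_norm_sq
  obtain ⟨r, hr⟩ := CStarAlgebra.nonneg_iff_eq_star_mul_self.1 h
  have e : star a * a = ((‖a‖ ^ 2 : ℝ) : ℂ) • (1 : A) - star r * r := by
    rw [← hr, Algebra.algebraMap_eq_smul_one, Complex.coe_smul]
    abel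
  have h1 : ∀ b : A, ‖Θ b x‖ ^ 2 = RCLike.re (inner ℂ x (Θ (star b * b) x)) := fun b => by
    rw [← inner_self_eq_norm_sq (𝕜 := ℂ), hstar, ← Module.End.mul_apply, ← map_mul]
  have h2 : ‖Θ a x‖ ^ 2 = ‖a‖ ^ 2 * ‖x‖ ^ 2 - ‖Θ r x‖ ^ 2 := by
    rw [h1 a, h1 r, e, ← inner_self_eq_norm_sq (𝕜 := ℂ) x, map_sub, map_smul, map_one,
      LinearMap.sub_apply, inner_sub_right, LinearMap.smul_apply, Module.End.one_apply,
      inner_smul_right, map_sub]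
    congr 1
    exact Complex.re_ofReal_mul _ _
  refine le_of_sq_le_sq ?_ (by positivity)
  nlinarith [sq_nonneg ‖Θ r x‖]

section Pair

variable {H : Type*} [NormedAddCommGroup H] [InnerProductSpace ℂ H] [CompleteSpace H]
  {K : Type*} [NormedAddCommGroup K] [InnerProductSpace ℂ K] [CompleteSpace K]

/-- A representation of `A` on `H`, with values regarded as linear maps. -/
def repEnd (π : A →⋆ₐ[ℂ] (H →L[ℂ] H)) : A →ₐ[ℂ] Module.End ℂ H :=
  AlgHom.ofLinearMap ((ContinuousLinearMap.coeLM ℂ).comp π.toAlgHom.toLinearMap)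
    (by ext x; simp) (fun a b => by ext x; simp)

/-- The representation `π ⊗ ρ` of `A ⊗ B` on the algebraic tensor product `H ⊗ K`,
so that `(a ⊗ b) (h ⊗ k) = π a h ⊗ ρ b k`. -/
def tensorRep (π : A →⋆ₐ[ℂ] (H →L[ℂ] H)) (ρ : B →⋆ₐ[ℂ] (K →L[ℂ] K)) :
    A ⊗[ℂ] B →ₐ[ℂ] Module.End ℂ (H ⊗[ℂ] K) :=
  (Module.endTensorEndAlgHom (R := ℂ) (S := ℂ) (A := ℂ) (M := H) (N := K)).comp
    (Algebra.TensorProduct.map (repEnd π) (repEnd ρ))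

theorem tensorRep_tmul (π : A →⋆ₐ[ℂ] (H →L[ℂ] H)) (ρ : B →⋆ₐ[ℂ] (K →L[ℂ] K)) (a : A) (b : B)
    (h : H) (k : K) : tensorRep π ρ (a ⊗ₜ b) (h ⊗ₜ k) = π a h ⊗ₜ ρ b k := rfl

theorem tensorRep_star (π : A →⋆ₐ[ℂ] (H →L[ℂ] H)) (ρ : B →⋆ₐ[ℂ] (K →L[ℂ] K)) (t : A ⊗[ℂ] B)
    (x y : H ⊗[ℂ] K) :
    inner ℂ (tensorRep π ρ t x) y = inner ℂ x (tensorRep π ρ (star t) y) := by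
  induction t using TensorProduct.induction_on with
  | zero => simp
  | add s t hs ht => simp only [map_add, LinearMap.add_apply, star_add, inner_add_left,
      inner_add_right, hs, ht]
  | tmul a b =>
    induction x using TensorProduct.induction_on with
    | zero => simp
    | add x x' hx hx' => simp only [map_add, inner_add_left, hx, hx']
    | tmul h k =>
      induction y using TensorProduct.induction_on with
      | zero => simp
      | add y y' hy hy' => simp only [map_add, inner_add_right, hy, hy']
      | tmul h' k' =>
        rw [TensorProduct.star_tmul, tensorRep_tmul, tensorRep_tmul, TensorProduct.inner_tmul,
          TensorProduct.inner_tmul, StarHomClass.map_star π, StarHomClass.map_star ρ,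
          ContinuousLinearMap.star_eq_adjoint,
          ContinuousLinearMap.star_eq_adjoint, ContinuousLinearMap.adjoint_inner_right,
          ContinuousLinearMap.adjoint_inner_right]

theorem norm_tensorRep_tmul_le (π : A →⋆ₐ[ℂ] (H →L[ℂ] H)) (ρ : B →⋆ₐ[ℂ] (K →L[ℂ] K))
    (a : A) (b : B) (x : H ⊗[ℂ] K) :
    ‖tensorRep π ρ (a ⊗ₜ b) x‖ ≤ ‖a‖ * ‖b‖ * ‖x‖ := by
  have h1 := norm_rep_le ((tensorRep π ρ).comp Algebra.TensorProduct.includeLeft)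
    (fun t x y => by simpa using tensorRep_star π ρ (t ⊗ₜ 1) x y) a (tensorRep π ρ (1 ⊗ₜ b) x)
  have h2 := norm_rep_le ((tensorRep π ρ).comp Algebra.TensorProduct.includeRight)
    (fun t x y => by simpa using tensorRep_star π ρ (1 ⊗ₜ t) x y) b x
  have e : tensorRep π ρ (a ⊗ₜ b) x = tensorRep π ρ (a ⊗ₜ 1) (tensorRep π ρ (1 ⊗ₜ b) x) := by
    rw [← Module.End.mul_apply, ← map_mul, Algebra.TensorProduct.tmul_mul_tmul, mul_one, one_mul]
  simp only [AlgHom.comp_apply, Algebra.TensorProduct.includeLeft_apply,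
    Algebra.TensorProduct.includeRight_apply] at h1 h2
  rw [e, mul_assoc]
  exact h1.trans (mul_le_mul_of_nonneg_left h2 (norm_nonneg a))

theorem exists_bound_tensorRep (t : A ⊗[ℂ] B) : ∃ C : ℝ, 0 ≤ C ∧
    ∀ (H : Type u) [NormedAddCommGroup H] [InnerProductSpace ℂ H] [CompleteSpace H]
      (K : Type v) [NormedAddCommGroup K] [InnerProductSpace ℂ K] [CompleteSpace K]
      (π : A →⋆ₐ[ℂ] (H →L[ℂ] H)) (ρ : B →⋆ₐ[ℂ] (K →L[ℂ] K)) (x : H ⊗[ℂ] K),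
      ‖tensorRep π ρ t x‖ ≤ C * ‖x‖ := by
  induction t using TensorProduct.induction_on with
  | zero => exact ⟨0, le_rfl, fun H _ _ _ K _ _ _ π ρ x => by simp⟩
  | tmul a b =>
    exact ⟨‖a‖ * ‖b‖, by positivity, fun H _ _ _ K _ _ _ π ρ x =>
      norm_tensorRep_tmul_le π ρ a b x⟩
  | add s t hs ht =>
    obtain ⟨C, hC, h⟩ := hs
    obtain ⟨D, hD, h'⟩ := ht
    refine ⟨C + D, by positivity, fun H _ _ _ K _ _ _ π ρ x => ?_⟩
    rw [map_add, LinearMap.add_apply, add_mul]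
    exact (norm_add_le _ _).trans (add_le_add (h H K π ρ x) (h' H K π ρ x))

end Pair

/-- The C⋆-seminorm `t ↦ ‖(π ⊗ ρ) t‖` on `A ⊗ B` for representations `π` and `ρ` on Hilbert
spaces (the operator norm on the dense subspace `H ⊗ K` of the Hilbert space tensor product). -/
def pairSeminorm {H : Type u} [NormedAddCommGroup H] [InnerProductSpace ℂ H] [CompleteSpace H]
    {K : Type v} [NormedAddCommGroup K] [InnerProductSpace ℂ K] [CompleteSpace K]
    (π : A →⋆ₐ[ℂ] (H →L[ℂ] H)) (ρ : B →⋆ₐ[ℂ] (K →L[ℂ] K)) : CStarSeminorm (A ⊗[ℂ] B) :=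
  CStarSeminorm.ofRep (tensorRep π ρ) (tensorRep_star π ρ) fun t =>
    let ⟨C, _, h⟩ := exists_bound_tensorRep t
    ⟨C, h H K π ρ⟩

variable (A B)

/-- All the C⋆-seminorms `‖(π ⊗ ρ) ·‖` on `A ⊗ B`. -/
def spatialFamily : Set (CStarSeminorm (A ⊗[ℂ] B)) :=
  {p | ∃ (H : Type u) (_ : NormedAddCommGroup H) (_ : InnerProductSpace ℂ H)
      (_ : CompleteSpace H) (K : Type v) (_ : NormedAddCommGroup K) (_ : InnerProductSpace ℂ K)
      (_ : CompleteSpace K) (π : A →⋆ₐ[ℂ] (H →L[ℂ] H)) (ρ : B →⋆ₐ[ℂ] (K →L[ℂ] K)),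
      p = pairSeminorm π ρ}

theorem bddAbove_spatialFamily (t : A ⊗[ℂ] B) :
    BddAbove (Set.range fun p : spatialFamily A B => p.1 t) := by
  obtain ⟨C, hC, h⟩ := exists_bound_tensorRep t
  refine ⟨C, ?_⟩
  rintro _ ⟨⟨p, H, _, _, _, K, _, _, _, π, ρ, rfl⟩, rfl⟩
  exact CStarSeminorm.ofRep_apply_le (hstar := tensorRep_star π ρ) hC (h H K π ρ)

/-- The spatial (minimal) C⋆-norm on the algebraic tensor product `A ⊗ B`:
`‖t‖ = sup ‖(π ⊗ ρ) t‖` over all representations `π` of `A` and `ρ` of `B`. -/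
def spatialNorm : CStarSeminorm (A ⊗[ℂ] B) :=
  CStarSeminorm.sup (spatialFamily A B) (bddAbove_spatialFamily A B)

/-- The spatial (minimal) tensor product of C⋆-algebras. -/
abbrev SpatialTensor : Type (max u v) := (spatialNorm A B).Completion

variable {A B}

/-- The elementary tensor `a ⊗ b` in the spatial tensor product. -/
def stmul (a : A) (b : B) : SpatialTensor A B := (spatialNorm A B).of (a ⊗ₜ b)

end Tensor

section Universal

/-- The free complex unital ⋆-algebra on self-adjoint generators indexed by `X`: the
complexification of the real free algebra, the involution being complex conjugation on scalars and
the reversal of words. -/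
abbrev FreeStarAlgebra (X : Type u) : Type u := ℂ ⊗[ℝ] FreeAlgebra ℝ X

variable {X : Type u}

instance : StarModule ℝ (FreeAlgebra ℝ X) where
  star_smul c x := by
    rw [Algebra.smul_def, star_mul, FreeAlgebra.star_algebraMap, star_trivial c,
      Algebra.smul_def, Algebra.commutes]

instance : StarModule ℂ (FreeStarAlgebra X) where
  star_smul c x := by
    induction x using TensorProduct.induction_on with
    | zero => simp
    | tmul z w => simp [TensorProduct.smul_tmul']
    | add x y hx hy => simp only [smul_add, star_add, hx, hy]

/-- The generators of the free ⋆-algebra. -/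
def gen (i : X) : FreeStarAlgebra X := 1 ⊗ₜ FreeAlgebra.ι ℝ i

theorem star_gen (i : X) : star (gen i) = gen i := by simp [gen]

/-- The C⋆-seminorms on the free ⋆-algebra for which the generators are contractions and the
elements of `R` vanish. -/
def relationFamily (R : Set (FreeStarAlgebra X)) : Set (CStarSeminorm (FreeStarAlgebra X)) :=
  {p | (∀ i, p (gen i) ≤ 1) ∧ ∀ r ∈ R, p r = 0}

theorem bddAbove_relationFamily (R : Set (FreeStarAlgebra X)) (t : FreeStarAlgebra X) :
    BddAbove (Set.range fun p : relationFamily R => p.1 t) := by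
  have hone : ∀ p : CStarSeminorm (FreeStarAlgebra X), p 1 ≤ 1 := fun p => by
    have h := p.star_mul_self 1
    rw [star_one, mul_one] at h
    nlinarith [p.nonneg 1]
  have key : ∀ w : FreeAlgebra ℝ X, ∃ C : ℝ, 0 ≤ C ∧ ∀ p : relationFamily R,
      p.1 ((1 : ℂ) ⊗ₜ[ℝ] w) ≤ C := fun w => by
    induction w using FreeAlgebra.induction with
    | grade0 r =>
      refine ⟨|r|, abs_nonneg r, fun p => ?_⟩
      have e : (1 : ℂ) ⊗ₜ[ℝ] algebraMap ℝ (FreeAlgebra ℝ X) r =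
          (r : ℂ) • (1 : FreeStarAlgebra X) := by
        rw [Algebra.algebraMap_eq_smul_one, TensorProduct.tmul_smul, Complex.coe_smul]
        rfl
      rw [e, map_smul_eq_mul p.1.toSeminorm, Complex.norm_real, Real.norm_eq_abs]
      exact mul_le_of_le_one_right (abs_nonneg r) (hone p.1)
    | grade1 x => exact ⟨1, zero_le_one, fun p => p.2.1 x⟩
    | mul a b ha hb =>
      obtain ⟨C, hC, h⟩ := ha
      obtain ⟨D, hD, h'⟩ := hb
      refine ⟨C * D, by positivity, fun p => ?_⟩
      have e : (1 : ℂ) ⊗ₜ[ℝ] (a * b) = ((1 : ℂ) ⊗ₜ[ℝ] a) * ((1 : ℂ) ⊗ₜ[ℝ] b) := by simp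
      rw [e]
      exact (p.1.mul_le _ _).trans (mul_le_mul (h p) (h' p) (p.1.nonneg _) hC)
    | add a b ha hb =>
      obtain ⟨C, hC, h⟩ := ha
      obtain ⟨D, hD, h'⟩ := hb
      refine ⟨C + D, by positivity, fun p => ?_⟩
      rw [TensorProduct.tmul_add]
      exact (map_add_le_add p.1.toSeminorm _ _).trans (add_le_add (h p) (h' p))
  suffices h : ∃ C : ℝ, ∀ p : relationFamily R, p.1 t ≤ C by
    obtain ⟨C, h⟩ := h
    exact ⟨C, by rintro _ ⟨p, rfl⟩; exact h p⟩
  induction t using TensorProduct.induction_on with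
  | zero => exact ⟨0, fun p => (map_zero p.1.toSeminorm).le⟩
  | tmul z w =>
    obtain ⟨C, hC, h⟩ := key w
    refine ⟨‖z‖ * C, fun p => ?_⟩
    have e : z ⊗ₜ[ℝ] w = z • ((1 : ℂ) ⊗ₜ[ℝ] w) := by simp [TensorProduct.smul_tmul']
    rw [e, map_smul_eq_mul p.1.toSeminorm]
    exact mul_le_mul_of_nonneg_left (h p) (norm_nonneg z)
  | add x y hx hy =>
    obtain ⟨C, h⟩ := hx
    obtain ⟨D, h'⟩ := hy
    exact ⟨C + D, fun p =>
      (map_add_le_add p.1.toSeminorm _ _).trans (add_le_add (h p) (h' p))⟩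

/-- The universal unital C⋆-algebra generated by self-adjoint contractions indexed by `X`, subject
to the relations `r = 0` for `r ∈ R`: the completion of the free ⋆-algebra in the largest
C⋆-seminorm compatible with the relations. -/
abbrev UniversalCStarAlgebra (R : Set (FreeStarAlgebra X)) : Type u :=
  (CStarSeminorm.sup (relationFamily R) (bddAbove_relationFamily R)).Completion

end Universal

section QuantumGroups

variable {N : ℕ}

/-- A unital C⋆-algebra with a distinguished `N × N` matrix of elements ("coordinates"). -/
structure CoordAlgebra (N : ℕ) where
  /-- The underlying C⋆-algebra, to be thought of as `C(G)`. -/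
  A : Type u
  [cstar : CStarAlgebra A]
  /-- The matrix of standard coordinates. -/
  u : Matrix (Fin N) (Fin N) A

attribute [instance] CoordAlgebra.cstar

namespace CoordAlgebra

/-- The ⋆-subalgebra generated by the coordinates. -/
def poly (G : CoordAlgebra.{u} N) : StarSubalgebra ℂ G.A :=
  StarAlgebra.adjoin ℂ {a | ∃ i j, a = G.u i j}

theorem u_mem_poly (G : CoordAlgebra.{u} N) (i j : Fin N) : G.u i j ∈ G.poly :=
  StarAlgebra.subset_adjoin ℂ _ ⟨i, j, rfl⟩

/-- The coordinates, as elements of the ⋆-subalgebra they generate. -/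
def polyU (G : CoordAlgebra.{u} N) (i j : Fin N) : G.poly := ⟨G.u i j, G.u_mem_poly i j⟩

/-- `(A, u)` is the algebra of continuous functions on a closed quantum subgroup `G ⊆ O_N⁺`:
a compact matrix quantum group in the sense of Woronowicz whose fundamental corepresentation `u`
has self-adjoint entries and is orthogonal. -/
structure IsQuantumSubgroup (G : CoordAlgebra.{u} N) : Prop where
  nontrivial : Nontrivial G.A
  selfAdjoint : ∀ i j, star (G.u i j) = G.u i j
  mul_transpose : G.u * G.u.transpose = 1
  transpose_mul : G.u.transpose * G.u = 1
  /-- The coordinates generate `A`. -/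
  dense : Dense (G.poly : Set G.A)
  /-- Comultiplication. -/
  comul : ∃ Δ : G.A →⋆ₐ[ℂ] SpatialTensor G.A G.A,
    ∀ i j, Δ (G.u i j) = ∑ k, stmul (G.u i k) (G.u k j)
  /-- Coinverse (antipode), on the dense ⋆-subalgebra of polynomial functions. -/
  coinverse : ∃ κ : G.poly →ₗ[ℂ] G.poly, (∀ a b, κ (a * b) = κ b * κ a) ∧
    (∀ a, κ (star (κ (star a))) = a) ∧
    (∀ i j, ∑ k, κ (G.polyU i k) * G.polyU k j = if i = j then 1 else 0) ∧
    ∀ i j, ∑ k, G.polyU i k * κ (G.polyU k j) = if i = j then 1 else 0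

/-- `H ⊆ G` as quantum subgroups of `O_N⁺`: the restriction map `C(G) → C(H)`, sending coordinates
to coordinates, is a (well-defined) ⋆-homomorphism. -/
def IsSubgroupOf (H : CoordAlgebra.{u} N) (G : CoordAlgebra.{v} N) : Prop :=
  ∃ f : G.A →⋆ₐ[ℂ] H.A, ∀ i j, f (G.u i j) = H.u i j

/-- The coordinate function `x_i` on `X ⊆ ℝᴺ`, as an element of `C(X)`. -/
def coordFun (X : Set (EuclideanSpace ℝ (Fin N))) (i : Fin N) : C(X, ℂ) :=
  ⟨fun p => (p.1 i : ℂ), by fun_prop⟩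

/-- The elementary tensor `a ⊗ f` in `A ⊗ C(X)`. The C⋆-algebra `A ⊗ C(X)` is `C(X, A)`, with
`a ⊗ f` being the function `p ↦ f(p) a`. -/
def funTensor {A : Type u} [CStarAlgebra A] {X : Type v} [TopologicalSpace X] (a : A)
    (f : C(X, ℂ)) : C(X, A) :=
  ⟨fun p => f p • a, by fun_prop⟩

/-- `G` acts affinely on the compact space `X ⊆ ℝᴺ`: there is a ⋆-homomorphism
`Φ : C(X) → C(G) ⊗ C(X)` with `Φ(x_i) = ∑ j, u_ij ⊗ x_j`. -/
def ActsAffinely (G : CoordAlgebra.{u} N) (X : Set (EuclideanSpace ℝ (Fin N)))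
    [CompactSpace X] : Prop :=
  ∃ Φ : C(X, ℂ) →⋆ₐ[ℂ] C(X, G.A),
    ∀ i, Φ (coordFun X i) = ∑ j, funTensor (G.u i j) (coordFun X j)

/-- `G` is the quantum isometry group of `X`: the universal object among the closed
quantum subgroups of `O_N⁺` acting affinely on `X`. -/
structure IsQuantumIsometryGroup (X : Set (EuclideanSpace ℝ (Fin N))) [CompactSpace X]
    (G : CoordAlgebra.{v} N) : Prop where
  isQuantumSubgroup : G.IsQuantumSubgroup
  actsAffinely : G.ActsAffinely X
  universal : ∀ H : CoordAlgebra.{u} N, H.IsQuantumSubgroup → H.ActsAffinely X →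
    H.IsSubgroupOf G

/-- The algebra `C(S)` of continuous functions on a compact set `S` of real matrices, with the
functions `U ↦ U i j` as coordinates. -/
def ofMatrices (S : Set (Matrix (Fin N) (Fin N) ℝ)) [CompactSpace S] : CoordAlgebra.{0} N where
  A := C(S, ℂ)
  u i j := ⟨fun U => (U.1 i j : ℂ),
    Complex.continuous_ofReal.comp (continuous_subtype_val.matrix_elem i j)⟩

end CoordAlgebra

variable (N)

/-- The orthogonal group `O_N`, as a set of matrices. -/
def orthogonalMatrices : Set (Matrix (Fin N) (Fin N) ℝ) := Matrix.orthogonalGroup (Fin N) ℝ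

/-- The hyperoctahedral group `H_N = ℤ₂ ≀ S_N`, as the set of signed permutation matrices. -/
def signedPermutations : Set (Matrix (Fin N) (Fin N) ℝ) :=
  Set.range fun e : Equiv.Perm (Fin N) × (Fin N → ℤˣ) =>
    Matrix.of fun i j => if j = e.1 i then ((e.2 i : ℤ) : ℝ) else 0

instance : CompactSpace (orthogonalMatrices N) := by
  rw [← isCompact_iff_compactSpace]
  have hc : IsCompact (Set.univ.pi fun _ : Fin N => Set.univ.pi fun _ : Fin N =>
      Set.Icc (-1 : ℝ) 1) :=
    isCompact_univ_pi fun _ => isCompact_univ_pi fun _ => isCompact_Icc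
  refine hc.of_isClosed_subset ?_ fun U hU i _ j _ => ?_
  · have : orthogonalMatrices N = {U | U * U.transpose = 1} := by
      ext U; exact Matrix.mem_orthogonalGroup_iff _ _
    rw [this]
    exact isClosed_eq (by fun_prop) continuous_const
  · have h : ∑ k, U i k * U i k = 1 :=
      (congrFun (congrFun ((Matrix.mem_orthogonalGroup_iff _ _).1 hU) i) i).trans
        (Matrix.one_apply_eq i)
    have h1 : U i j * U i j ≤ ∑ k, U i k * U i k :=
      Finset.single_le_sum (f := fun k => U i k * U i k) (fun k _ => mul_self_nonneg _)
        (Finset.mem_univ j)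
    have h2 : U i j * U i j ≤ 1 := h1.trans h.le
    exact abs_le.1 (abs_le_one_iff_mul_self_le_one.2 h2)

instance : CompactSpace (signedPermutations N) := by
  rw [← isCompact_iff_compactSpace]
  exact (Set.finite_range _).isCompact

/-- The coordinate algebra `C(O_N)` of the orthogonal group. -/
def orthogonalGroup : CoordAlgebra.{0} N := .ofMatrices (orthogonalMatrices N)

/-- The coordinate algebra `C(H_N)` of the hyperoctahedral group. -/
def hyperoctahedralGroup : CoordAlgebra.{0} N := .ofMatrices (signedPermutations N)

/-- The generators `u_ij` of the free ⋆-algebra on `N²` self-adjoint generators. -/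
def ugen {N : ℕ} (i j : Fin N) : FreeStarAlgebra (Fin N × Fin N) := gen (i, j)

/-- The relations `u uᵗ = uᵗ u = 1`, which define `O_N⁺`. -/
def orthogonalRelations : Set (FreeStarAlgebra (Fin N × Fin N)) :=
  {r | ∃ i j, r = ∑ k, ugen i k * ugen j k - if i = j then 1 else 0} ∪
    {r | ∃ i j, r = ∑ k, ugen k i * ugen k j - if i = j then 1 else 0}

/-- The relations `ab = 0` for distinct entries `a, b` of `u` on the same row or column. -/
def cubicRelations : Set (FreeStarAlgebra (Fin N × Fin N)) :=
  {r | ∃ i j k, j ≠ k ∧ r = ugen i j * ugen i k} ∪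
    {r | ∃ i j k, j ≠ k ∧ r = ugen j i * ugen k i}

/-- The free hyperoctahedral group `H_N⁺`: its algebra `C(H_N⁺)` is the universal C⋆-algebra
generated by the self-adjoint entries of an `N × N` orthogonal matrix, distinct entries on the same
row or column having product zero. (That the generators are contractions follows from
orthogonality, so imposing it is no restriction.) -/
def freeHyperoctahedralGroup : CoordAlgebra.{0} N where
  A := UniversalCStarAlgebra (orthogonalRelations N ∪ cubicRelations N)
  u i j := CStarSeminorm.of _ (ugen i j)

/-- The polygonal sphere `S^{N-1,d-1}`: the points `x` of the unit sphere of `ℝᴺ` such that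
`x_{i_0} ⋯ x_{i_d} = 0` for all distinct `i_0, …, i_d`. -/
def polygonalSphere (d : ℕ) : Set (EuclideanSpace ℝ (Fin N)) :=
  {x | x ∈ Metric.sphere 0 1 ∧ ∀ i : Fin (d + 1) ↪ Fin N, ∏ a, x (i a) = 0}

instance (d : ℕ) : CompactSpace (polygonalSphere N d) := by
  rw [← isCompact_iff_compactSpace]
  refine (isCompact_sphere (0 : EuclideanSpace ℝ (Fin N)) 1).inter_right ?_
  change IsClosed {x : EuclideanSpace ℝ (Fin N) | ∀ i : Fin (d + 1) ↪ Fin N, ∏ a, x (i a) = 0}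
  simp only [Set.ofPred_forall]
  exact isClosed_iInter fun i => isClosed_eq (by fun_prop) continuous_const

end QuantumGroups

end PolygonalSphere

end

/-!
A commutative quantum subgroup of `O_N⁺` is, by Gelfand duality, a compact group of orthogonal
matrices, so the question splits into forcing commutativity and solving the classical problem.
Evaluating an affine action at a point `x` gives a ⋆-homomorphism on a commutative algebra that
takes the values `(u x)_i = ∑ j, u_ij x_j` at the coordinates, so the entries of `u x` commute.

* If `d ≥ 2`, the sphere contains points with two nonzero coordinates; polarizing gives
  `⁅u_ij, u_kl⁆ + ⁅u_il, u_kj⁆ = 0`. The antipode yields the transposed identity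
  `⁅u_ij, u_kl⁆ + ⁅u_kj, u_il⁆ = 0`, and adding the two shows that all coordinates commute.
* If `d < N`, a classical orthogonal matrix preserving the sphere maps the span of any `d` basis
  vectors, hence a generic vector of it, to vectors with at most `d` nonzero entries. So these `d`
  columns live on at most `d` rows, which orthonormality then makes vanish in all other columns:
  no row has two nonzero entries.
* If `d = 1`, the sphere is `{±e_i}`, where `x_i x_j = 0` for `i ≠ j`; evaluating at `e_k` and
  applying the antipode gives the relations of `H_N⁺`. Conversely these relations make the
  spectral projections `((u x)_i² ± (u x)_i) / 2` a partition of unity indexed by `{±e_i}`, which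
  defines the action.
-/

noncomputable section

namespace PolygonalSphere

/-! ### C⋆-seminorms and universal C⋆-algebras -/

namespace CStarSeminorm

variable {F : Type u} [Ring F] [StarRing F] [Algebra ℂ F]

theorem le_sup {P : Set (CStarSeminorm F)} (hP : ∀ x, BddAbove (Set.range fun p : P => p.1 x))
    {p : CStarSeminorm F} (hp : p ∈ P) (x : F) : p x ≤ sup P hP x :=
  le_ciSup (hP x) ⟨p, hp⟩

theorem sup_eq_zero {P : Set (CStarSeminorm F)}
    (hP : ∀ x, BddAbove (Set.range fun p : P => p.1 x)) {x : F} (hx : ∀ p ∈ P, p x = 0) :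
    sup P hP x = 0 :=
  le_antisymm (Real.iSup_le (fun p => (hx p.1 p.2).le) le_rfl) (nonneg _ x)

section Lift

variable {B : Type v} [NormedRing B] [StarRing B] [NormedAlgebra ℂ B]

/-- A ⋆-homomorphism on `F`, regarded as a ring homomorphism on the topologised copy of `F`. -/
def preHom (p : CStarSeminorm F) (φ : F →⋆ₐ[ℂ] B) : p.Pre →+* B := (φ : F →+* B)

theorem continuous_preHom {p : CStarSeminorm F} {φ : F →⋆ₐ[ℂ] B} (hφ : ∀ x, ‖φ x‖ ≤ p x) :
    Continuous (p.preHom φ) :=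
  AddMonoidHomClass.continuous_of_bound (p.preHom φ) 1 fun x => (hφ x).trans_eq (one_mul _).symm

variable [CStarRing B]

/-- The C⋆-seminorm `x ↦ ‖φ x‖` induced by a ⋆-homomorphism `φ` into a C⋆-algebra. -/
def ofStarAlgHom (φ : F →⋆ₐ[ℂ] B) : CStarSeminorm F where
  toFun x := ‖φ x‖
  map_zero' := by simp
  add_le' x y := by simpa using norm_add_le (φ x) (φ y)
  neg' x := by simp
  smul' c x := by simp [norm_smul]
  mul_le' x y := by simpa using norm_mul_le (φ x) (φ y)
  star_mul_self' x := by rw [map_mul, map_star, CStarRing.norm_star_mul_self, sq]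

variable [CompleteSpace B]

/-- The extension to the completion of a ⋆-homomorphism dominated by a C⋆-seminorm. -/
def lift (p : CStarSeminorm F) (φ : F →⋆ₐ[ℂ] B) (hφ : ∀ x, ‖φ x‖ ≤ p x) :
    p.Completion →⋆ₐ[ℂ] B :=
  let f : p.Completion →+* B :=
    UniformSpace.Completion.extensionHom (p.preHom φ) (continuous_preHom hφ)
  have hof (x : F) : f (p.of x) = φ x :=
    UniformSpace.Completion.extensionHom_coe (p.preHom φ) (continuous_preHom hφ) x
  { f with
    commutes' := fun c => by
      calc f (algebraMap ℂ p.Completion c) = f (p.of (c • 1)) := by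
            rw [of_smul, of_one, Algebra.algebraMap_eq_smul_one]
        _ = algebraMap ℂ B c := by
            rw [hof, map_smul, map_one, Algebra.algebraMap_eq_smul_one]
    map_star' := by
      have hf : Continuous f := UniformSpace.Completion.continuous_extension
      refine p.induction (isClosed_eq (hf.comp p.continuous_star) hf.star) fun x => ?_
      change f (star (p.of x)) = star (f (p.of x))
      rw [← of_star, hof, hof, map_star] }

theorem lift_of (p : CStarSeminorm F) (φ : F →⋆ₐ[ℂ] B) (hφ : ∀ x, ‖φ x‖ ≤ p x) (x : F) :
    p.lift φ hφ (p.of x) = φ x :=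
  UniformSpace.Completion.extensionHom_coe (p.preHom φ) (continuous_preHom hφ) x

end Lift

end CStarSeminorm

namespace FreeStarAlgebra

variable {X : Type u}

theorem adjoin_range_gen : StarAlgebra.adjoin ℂ (Set.range (gen (X := X))) = ⊤ := by
  set S := StarAlgebra.adjoin ℂ (Set.range (gen (X := X)))
  have hword (w : FreeAlgebra ℝ X) : (1 : ℂ) ⊗ₜ[ℝ] w ∈ S := by
    induction w using FreeAlgebra.induction with
    | grade0 r =>
      rw [Algebra.algebraMap_eq_smul_one, ← TensorProduct.smul_tmul]
      exact S.algebraMap_mem (r • 1 : ℂ)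
    | grade1 x => exact StarAlgebra.subset_adjoin ℂ _ ⟨x, rfl⟩
    | mul a b ha hb => simpa using mul_mem ha hb
    | add a b ha hb => simpa only [TensorProduct.tmul_add] using add_mem ha hb
  refine eq_top_iff.2 fun t _ => ?_
  induction t using TensorProduct.induction_on with
  | zero => exact zero_mem S
  | tmul z w => simpa [TensorProduct.smul_tmul'] using S.smul_mem (hword w) z
  | add x y hx hy => exact add_mem (hx trivial) (hy trivial)

section Lift

variable {B : Type v} [Ring B] [Algebra ℂ B]

/-- The algebra homomorphism from the free ⋆-algebra sending the generators to `g`. -/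
def liftAlgHom (g : X → B) : FreeStarAlgebra X →ₐ[ℂ] B :=
  Algebra.TensorProduct.lift (Algebra.ofId ℂ B) (FreeAlgebra.lift ℝ g)
    fun z _ => by rw [Algebra.ofId_apply]; exact Algebra.commute_algebraMap_left z _

theorem liftAlgHom_tmul (g : X → B) (z : ℂ) (w : FreeAlgebra ℝ X) :
    liftAlgHom g (z ⊗ₜ w) = z • FreeAlgebra.lift ℝ g w := by
  rw [liftAlgHom, Algebra.TensorProduct.lift_tmul, Algebra.smul_def, Algebra.ofId_apply]

variable [StarRing B]

theorem lift_star [StarModule ℝ B] {g : X → B} (hg : ∀ i, star (g i) = g i)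
    (w : FreeAlgebra ℝ X) :
    FreeAlgebra.lift ℝ g (star w) = star (FreeAlgebra.lift ℝ g w) := by
  induction w using FreeAlgebra.induction with
  | grade0 r => simp [Algebra.algebraMap_eq_smul_one]
  | grade1 x => simp [hg]
  | mul a b ha hb => simp [ha, hb]
  | add a b ha hb => simp [ha, hb]

variable [StarModule ℂ B]

/-- The ⋆-homomorphism from the free ⋆-algebra sending the generators to the self-adjoint
elements `g`. -/
def lift (g : X → B) (hg : ∀ i, star (g i) = g i) : FreeStarAlgebra X →⋆ₐ[ℂ] B where
  toAlgHom := liftAlgHom g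
  map_star' t := by
    change liftAlgHom g (star t) = star (liftAlgHom g t)
    induction t using TensorProduct.induction_on with
    | zero => simp
    | tmul z w =>
      rw [TensorProduct.star_tmul, liftAlgHom_tmul, liftAlgHom_tmul, lift_star hg, star_smul]
    | add x y hx hy => rw [star_add, map_add, map_add, star_add, hx, hy]

theorem lift_gen (g : X → B) (hg : ∀ i, star (g i) = g i) (i : X) :
    lift g hg (gen i) = g i :=
  (liftAlgHom_tmul g 1 _).trans <| by rw [one_smul, FreeAlgebra.lift_ι_apply]

end Lift

end FreeStarAlgebra

namespace UniversalCStarAlgebra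

variable {X : Type u} (R : Set (FreeStarAlgebra X))

/-- The largest C⋆-seminorm compatible with the relations `R`, whose completion is
`UniversalCStarAlgebra R`. -/
abbrev relationSeminorm : CStarSeminorm (FreeStarAlgebra X) :=
  CStarSeminorm.sup (relationFamily R) (bddAbove_relationFamily R)

/-- The canonical ⋆-homomorphism from the free ⋆-algebra to the universal C⋆-algebra. -/
def mk : FreeStarAlgebra X →⋆ₐ[ℂ] UniversalCStarAlgebra R := (relationSeminorm R).ofHom

variable {R}

theorem mk_eq_zero {r : FreeStarAlgebra X} (hr : r ∈ R) : mk R r = 0 :=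
  norm_eq_zero.1 <| ((relationSeminorm R).norm_of r).trans <|
    CStarSeminorm.sup_eq_zero _ fun _ hp => hp.2 r hr

variable (R) in
theorem dense_adjoin_mk_gen : Dense
    (StarAlgebra.adjoin ℂ (Set.range fun i => mk R (gen i)) : Set (UniversalCStarAlgebra R)) := by
  have h : StarAlgebra.adjoin ℂ (Set.range fun i => mk R (gen i)) = (mk R).range := by
    rw [Set.range_comp' (mk R) gen, ← StarAlgHom.map_adjoin, FreeStarAlgebra.adjoin_range_gen,
      StarAlgHom.range_eq_map_top]
  rw [h]
  exact (relationSeminorm R).denseRange_of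

variable {B : Type v} [CStarAlgebra B]

theorem exists_lift {g : X → B} (hg : ∀ i, star (g i) = g i) (hnorm : ∀ i, ‖g i‖ ≤ 1)
    (hR : ∀ r ∈ R, FreeStarAlgebra.lift g hg r = 0) :
    ∃ f : UniversalCStarAlgebra R →⋆ₐ[ℂ] B, ∀ i, f (mk R (gen i)) = g i := by
  set φ := FreeStarAlgebra.lift g hg
  have hφ : CStarSeminorm.ofStarAlgHom φ ∈ relationFamily R :=
    ⟨fun i => (congrArg norm (FreeStarAlgebra.lift_gen g hg i)).trans_le (hnorm i),
      fun r hr => norm_eq_zero.2 (hR r hr)⟩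
  refine ⟨(relationSeminorm R).lift φ (CStarSeminorm.le_sup (bddAbove_relationFamily R) hφ),
    fun i => ?_⟩
  exact (CStarSeminorm.lift_of ..).trans (FreeStarAlgebra.lift_gen g hg i)

end UniversalCStarAlgebra

theorem norm_le_one_of_sum_star_mul_self {A : Type*} [CStarAlgebra A] {ι : Type*} [Fintype ι]
    {a : ι → A} (h : ∑ j, star (a j) * a j = 1) (i : ι) : ‖a i‖ ≤ 1 := by
  let := CStarAlgebra.spectralOrder A
  let := CStarAlgebra.spectralOrderedRing A
  have hle : star (a i) * a i ≤ 1 :=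
    h ▸ Finset.single_le_sum (fun j _ => star_mul_self_nonneg (a j)) (Finset.mem_univ i)
  have hsq := (CStarAlgebra.norm_le_one_iff_of_nonneg _ (star_mul_self_nonneg (a i))).2 hle
  rw [CStarRing.norm_star_mul_self] at hsq
  nlinarith [norm_nonneg (a i)]

/-! ### The spatial tensor product -/

section Spatial

variable {A : Type u} {B : Type v} [CStarAlgebra A] [CStarAlgebra B]

/-- The ⋆-homomorphism `a ↦ a ⊗ 1` into the spatial tensor product. -/
def stmulOne : A →⋆ₐ[ℂ] SpatialTensor A B :=
  (spatialNorm A B).ofHom.comp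
    { (Algebra.TensorProduct.includeLeft : A →ₐ[ℂ] A ⊗[ℂ] B) with
      map_star' := fun a => by simp }

/-- The ⋆-homomorphism `b ↦ 1 ⊗ b` into the spatial tensor product. -/
def oneStmul : B →⋆ₐ[ℂ] SpatialTensor A B :=
  (spatialNorm A B).ofHom.comp
    { (Algebra.TensorProduct.includeRight : B →ₐ[ℂ] A ⊗[ℂ] B) with
      map_star' := fun b => by simp }

theorem stmulOne_mul_oneStmul (a : A) (b : B) :
    (stmulOne a * oneStmul b : SpatialTensor A B) = stmul a b :=
  ((spatialNorm A B).of_mul (a ⊗ₜ 1) (1 ⊗ₜ b)).symm.trans <| by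
    rw [stmul, Algebra.TensorProduct.tmul_mul_tmul, mul_one, one_mul]

theorem commute_stmulOne_oneStmul (a : A) (b : B) :
    Commute (stmulOne a : SpatialTensor A B) (oneStmul b) :=
  (stmulOne_mul_oneStmul a b).trans <| .trans
    (by rw [stmul, Algebra.TensorProduct.tmul_mul_tmul, mul_one, one_mul])
    ((spatialNorm A B).of_mul (1 ⊗ₜ b) (a ⊗ₜ 1))

end Spatial

theorem SpatialTensor.mul_comm {A : Type u} {B : Type v} [CommCStarAlgebra A]
    [CommCStarAlgebra B] (x y : SpatialTensor A B) : x * y = y * x :=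
  (spatialNorm A B).denseRange_of.induction_on₂
    (isClosed_eq (by fun_prop) (by fun_prop))
    (fun s t => by rw [← CStarSeminorm.of_mul, ← CStarSeminorm.of_mul, _root_.mul_comm s t]) x y

open CoordAlgebra

/-! ### Orthogonal and cubic matrices over a ⋆-ring -/

section Matrices

open Matrix MulOpposite

variable {n R : Type*} [Fintype n] [Ring R]

theorem transpose_mul_of_commute {v w : Matrix n n R}
    (h : ∀ i j k l, Commute (v i j) (w k l)) : (v * w)ᵀ = wᵀ * vᵀ := by
  ext i j
  simp only [transpose_apply, mul_apply]
  exact Finset.sum_congr rfl fun k _ => h j k k i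

variable [DecidableEq n] [StarRing R]

/-- The relations defining `O_N⁺`: the entries of `v` are self-adjoint and `v vᵗ = vᵗ v = 1`. -/
structure IsOrthogonal (v : Matrix n n R) : Prop where
  star_eq : ∀ i j, star (v i j) = v i j
  mul_transpose : v * vᵀ = 1
  transpose_mul : vᵀ * v = 1

/-- The relations defining `H_N⁺`: `v` is orthogonal, and distinct entries on the same row or
column have product zero. -/
structure IsCubic (v : Matrix n n R) : Prop extends IsOrthogonal v where
  mul_row : ∀ i {j k}, j ≠ k → v i j * v i k = 0
  mul_col : ∀ {i j} k, i ≠ j → v i k * v j k = 0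

namespace IsOrthogonal

variable {v w : Matrix n n R}

theorem sum_row (hv : IsOrthogonal v) (i j : n) :
    ∑ k, v i k * v j k = if i = j then 1 else 0 :=
  (congrFun₂ hv.mul_transpose i j).trans (one_apply ..)

theorem sum_col (hv : IsOrthogonal v) (i j : n) :
    ∑ k, v k i * v k j = if i = j then 1 else 0 :=
  (congrFun₂ hv.transpose_mul i j).trans (one_apply ..)

theorem exists_apply_ne_zero [Nontrivial R] (hv : IsOrthogonal v) (i : n) : ∃ j, v i j ≠ 0 := by
  by_contra! h
  simpa [h] using hv.sum_row i i

theorem one : IsOrthogonal (1 : Matrix n n R) where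
  star_eq i j := by rw [one_apply]; split_ifs <;> simp
  mul_transpose := by simp
  transpose_mul := by simp

theorem transpose (hv : IsOrthogonal v) : IsOrthogonal vᵀ :=
  ⟨fun i j => hv.star_eq j i, hv.transpose_mul, hv.mul_transpose⟩

theorem mul (hv : IsOrthogonal v) (hw : IsOrthogonal w)
    (h : ∀ i j k l, Commute (v i j) (w k l)) : IsOrthogonal (v * w) where
  star_eq i j := by
    simp only [mul_apply, star_sum, star_mul, hv.star_eq, hw.star_eq, (h _ _ _ _).eq]
  mul_transpose := by
    rw [transpose_mul_of_commute h, ← mul_assoc, mul_assoc v, hw.mul_transpose, mul_one,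
      hv.mul_transpose]
  transpose_mul := by
    rw [transpose_mul_of_commute h, ← mul_assoc, mul_assoc wᵀ, hv.transpose_mul, mul_one,
      hw.transpose_mul]

theorem map_op (hv : IsOrthogonal v) : IsOrthogonal (v.map op) where
  star_eq i j := by rw [map_apply, ← op_star, hv.star_eq]
  mul_transpose := by
    ext i j
    simp only [mul_apply, transpose_apply, map_apply, ← op_mul, ← Finset.op_sum, hv.sum_row,
      one_apply, eq_comm (a := j)]
    split_ifs <;> rfl
  transpose_mul := by
    ext i j
    simp only [mul_apply, transpose_apply, map_apply, ← op_mul, ← Finset.op_sum, hv.sum_col,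
      one_apply, eq_comm (a := j)]
    split_ifs <;> rfl

theorem map {S F : Type*} [Ring S] [StarRing S] [FunLike F R S] [RingHomClass F R S]
    [StarHomClass F R S] (hv : IsOrthogonal v) (f : F) : IsOrthogonal (v.map f) where
  star_eq i j := by rw [map_apply, ← map_star, hv.star_eq]
  mul_transpose := by
    rw [← transpose_map, ← Matrix.map_mul, hv.mul_transpose,
      Matrix.map_one f (map_zero f) (map_one f)]
  transpose_mul := by
    rw [← transpose_map, ← Matrix.map_mul, hv.transpose_mul,
      Matrix.map_one f (map_zero f) (map_one f)]

theorem of_map {S F : Type*} [Ring S] [StarRing S] [FunLike F R S] [RingHomClass F R S]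
    [StarHomClass F R S] {f : F} (hf : Function.Injective f) (hv : IsOrthogonal (v.map f)) :
    IsOrthogonal v where
  star_eq i j := hf ((map_star f _).trans (hv.star_eq i j))
  mul_transpose := Matrix.map_injective hf <| by
    beta_reduce
    rw [Matrix.map_mul, Matrix.map_one _ (map_zero f) (map_one f)]
    exact hv.mul_transpose
  transpose_mul := Matrix.map_injective hf <| by
    beta_reduce
    rw [Matrix.map_mul, Matrix.map_one _ (map_zero f) (map_one f)]
    exact hv.transpose_mul

theorem of_forall_eval {X : Type*} [TopologicalSpace X] [TopologicalSpace R] [IsTopologicalRing R]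
    [ContinuousStar R] {v : Matrix n n C(X, R)} (h : ∀ x, IsOrthogonal (v.map fun f => f x)) :
    IsOrthogonal v where
  star_eq i j := ContinuousMap.ext fun x => (h x).star_eq i j
  mul_transpose := by
    ext i j x
    have := (h x).sum_row i j
    simp only [map_apply] at this
    rw [mul_apply, one_apply, ContinuousMap.sum_apply]
    exact this.trans (by split_ifs <;> rfl)
  transpose_mul := by
    ext i j x
    have := (h x).sum_col i j
    simp only [map_apply] at this
    rw [mul_apply, one_apply, ContinuousMap.sum_apply]
    exact this.trans (by split_ifs <;> rfl)

theorem norm_le_one {A : Type*} [CStarAlgebra A] {v : Matrix n n A} (hv : IsOrthogonal v)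
    (i j : n) : ‖v i j‖ ≤ 1 := by
  refine norm_le_one_of_sum_star_mul_self (a := fun i => v i j) ?_ i
  simpa only [hv.star_eq, if_true] using hv.sum_col j j

end IsOrthogonal

namespace IsCubic

variable {v w : Matrix n n R}

theorem one : IsCubic (1 : Matrix n n R) where
  toIsOrthogonal := .one
  mul_row i j k h := by
    simp only [one_apply]; split_ifs <;> simp_all
  mul_col k h := by
    simp only [one_apply]; split_ifs <;> simp_all

theorem transpose (hv : IsCubic v) : IsCubic vᵀ :=
  ⟨hv.toIsOrthogonal.transpose, fun i _ _ h => hv.mul_col i h, fun k h => hv.mul_row k h⟩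

theorem mul (hv : IsCubic v) (hw : IsCubic w) (h : ∀ i j k l, Commute (v i j) (w k l)) :
    IsCubic (v * w) where
  toIsOrthogonal := hv.toIsOrthogonal.mul hw.toIsOrthogonal h
  mul_row i j k hjk := by
    simp only [mul_apply, Finset.sum_mul_sum, (h _ _ _ _).symm.mul_mul_mul_comm]
    refine Finset.sum_eq_zero fun a _ => Finset.sum_eq_zero fun b _ => ?_
    obtain rfl | hab := eq_or_ne a b
    · rw [hw.mul_row a hjk, mul_zero]
    · rw [hv.mul_row i hab, zero_mul]
  mul_col k hij := by
    simp only [mul_apply, Finset.sum_mul_sum, (h _ _ _ _).symm.mul_mul_mul_comm]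
    refine Finset.sum_eq_zero fun a _ => Finset.sum_eq_zero fun b _ => ?_
    obtain rfl | hab := eq_or_ne a b
    · rw [hv.mul_col a hij, zero_mul]
    · rw [hw.mul_col k hab, mul_zero]

theorem map_op (hv : IsCubic v) : IsCubic (v.map op) where
  toIsOrthogonal := hv.toIsOrthogonal.map_op
  mul_row i j k h := by simp only [map_apply, ← op_mul, hv.mul_row i h.symm, op_zero]
  mul_col k h := by simp only [map_apply, ← op_mul, hv.mul_col k h.symm, op_zero]

theorem map {S F : Type*} [Ring S] [StarRing S] [FunLike F R S] [RingHomClass F R S]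
    [StarHomClass F R S] (hv : IsCubic v) (f : F) : IsCubic (v.map f) where
  toIsOrthogonal := hv.toIsOrthogonal.map f
  mul_row i j k h := by simp only [map_apply, ← map_mul, hv.mul_row i h, map_zero]
  mul_col k h := by simp only [map_apply, ← map_mul, hv.mul_col k h, map_zero]

end IsCubic

end Matrices

variable {N : ℕ}

theorem mem_orthogonalMatrices_iff {U : Matrix (Fin N) (Fin N) ℝ} :
    U ∈ orthogonalMatrices N ↔ IsOrthogonal U :=
  ⟨fun hU => ⟨fun _ _ => star_trivial _, (Matrix.mem_orthogonalGroup_iff _ _).1 hU,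
    (Matrix.mem_orthogonalGroup_iff' _ _).1 hU⟩,
    fun hU => (Matrix.mem_orthogonalGroup_iff _ _).2 hU.mul_transpose⟩

theorem IsOrthogonal.mem_signedPermutations {U : Matrix (Fin N) (Fin N) ℝ} (hU : IsOrthogonal U)
    (hrow : ∀ i {j k}, j ≠ k → U i j * U i k = 0) : U ∈ signedPermutations N := by
  choose σ hσ using hU.exists_apply_ne_zero
  have hzero {i j} (hj : j ≠ σ i) : U i j = 0 :=
    (mul_eq_zero.1 (hrow i hj)).resolve_right (hσ i)
  have hprod (i j) : U i (σ i) * U j (σ i) = if i = j then 1 else 0 := by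
    rw [← hU.sum_row, Fintype.sum_eq_single (σ i) fun k hk => by rw [hzero hk, zero_mul]]
  have hσ_inj : Function.Injective σ := fun i j hij => by
    by_contra hne
    exact mul_ne_zero (hσ i) (hij ▸ hσ j) ((hprod i j).trans (if_neg hne))
  have hsign (i) : ∃ ε : ℤˣ, U i (σ i) = ((ε : ℤ) : ℝ) := by
    obtain h | h := mul_self_eq_one_iff.1 ((hprod i i).trans (if_pos rfl))
    · exact ⟨1, by simpa using h⟩
    · exact ⟨-1, by simpa using h⟩
  choose ε hε using hsign
  refine ⟨(.ofBijective σ (Finite.injective_iff_bijective.1 hσ_inj), ε), ?_⟩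
  ext i j
  simp only [Matrix.of_apply, Equiv.ofBijective_apply]
  split_ifs with hj
  · rw [hj, hε]
  · rw [hzero hj]

theorem isCubic_of_mem_signedPermutations {U : Matrix (Fin N) (Fin N) ℝ}
    (hU : U ∈ signedPermutations N) : IsCubic U := by
  obtain ⟨⟨σ, ε⟩, rfl⟩ := hU
  refine ⟨mem_orthogonalMatrices_iff.1 ((Matrix.mem_orthogonalGroup_iff _ _).2 ?_),
    fun i j k hjk => ?_, fun {i j} k hij => ?_⟩
  · ext i j
    simp only [Matrix.mul_apply, Matrix.of_apply, Matrix.one_apply, ite_mul, zero_mul,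
      Finset.sum_ite_eq', Finset.mem_univ, if_true]
    obtain rfl | hij := eq_or_ne i j
    · obtain h | h := Int.units_eq_one_or (ε i) <;> simp [h]
    · simp [hij]
  · simp only [Matrix.of_apply]
    split_ifs <;> simp_all
  · have := σ.injective.ne hij
    simp only [Matrix.of_apply]
    split_ifs <;> simp_all

theorem mem_signedPermutations_iff {U : Matrix (Fin N) (Fin N) ℝ} :
    U ∈ signedPermutations N ↔ IsCubic U :=
  ⟨isCubic_of_mem_signedPermutations, fun h => h.toIsOrthogonal.mem_signedPermutations h.mul_row⟩

theorem signedPermutations_subset_orthogonalMatrices :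
    signedPermutations N ⊆ orthogonalMatrices N := fun _ hU =>
  mem_orthogonalMatrices_iff.2 (mem_signedPermutations_iff.1 hU).toIsOrthogonal

namespace CoordAlgebra

theorem IsQuantumSubgroup.isOrthogonal {G : CoordAlgebra.{u} N} (hG : G.IsQuantumSubgroup) :
    IsOrthogonal G.u :=
  ⟨hG.selfAdjoint, hG.mul_transpose, hG.transpose_mul⟩

/-- The matrix `∑ k, u i k ⊗ u k j` of the values of the comultiplication at the coordinates. -/
def comulMatrix (G : CoordAlgebra.{u} N) : Matrix (Fin N) (Fin N) (SpatialTensor G.A G.A) :=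
  G.u.map stmulOne * G.u.map oneStmul

theorem comulMatrix_apply (G : CoordAlgebra.{u} N) (i j : Fin N) :
    G.comulMatrix i j = ∑ k, stmul (G.u i k) (G.u k j) := by
  simp only [comulMatrix, Matrix.mul_apply, Matrix.map_apply, stmulOne_mul_oneStmul]

theorem isCubic_comulMatrix {G : CoordAlgebra.{u} N} (hu : IsCubic G.u) :
    IsCubic G.comulMatrix :=
  (hu.map _).mul (hu.map _) fun _ _ _ _ => commute_stmulOne_oneStmul _ _

end CoordAlgebra

/-! ### Quantum subgroups from antihomomorphisms -/

namespace CoordAlgebra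

open MulOpposite

variable {G : CoordAlgebra.{u} N} {f : G.A →⋆ₐ[ℂ] G.Aᵐᵒᵖ}

theorem unop_mem_poly (hf : ∀ i j, f (G.u i j) = op (G.u j i)) {a : G.A} (ha : a ∈ G.poly) :
    (f a).unop ∈ G.poly := by
  induction ha using StarAlgebra.adjoin_induction with
  | mem x hx =>
    obtain ⟨i, j, rfl⟩ := hx
    exact hf i j ▸ G.u_mem_poly j i
  | algebraMap r =>
    rw [AlgHomClass.commutes]
    exact algebraMap_mem G.poly r
  | add x y _ _ hx hy => rw [map_add]; exact add_mem hx hy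
  | mul x y _ _ hx hy => rw [map_mul]; exact mul_mem hy hx
  | star x _ hx => rw [map_star]; exact star_mem hx

theorem unop_unop_of_mem_poly (hf : ∀ i j, f (G.u i j) = op (G.u j i)) {a : G.A}
    (ha : a ∈ G.poly) : (f (f a).unop).unop = a := by
  induction ha using StarAlgebra.adjoin_induction with
  | mem x hx =>
    obtain ⟨i, j, rfl⟩ := hx
    simp only [hf, unop_op]
  | algebraMap r => simp only [AlgHomClass.commutes, MulOpposite.algebraMap_apply, unop_op]
  | add x y _ _ hx hy => simp only [map_add, unop_add, hx, hy]
  | mul x y _ _ hx hy => simp only [map_mul, unop_mul, hx, hy]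
  | star x _ hx => simp only [map_star, unop_star, hx]

/-- The coinverse induced by a ⋆-antihomomorphism exchanging `u i j` and `u j i`. -/
def coinverseOfOp (f : G.A →⋆ₐ[ℂ] G.Aᵐᵒᵖ) (hf : ∀ i j, f (G.u i j) = op (G.u j i)) :
    G.poly →ₗ[ℂ] G.poly where
  toFun a := ⟨(f a).unop, unop_mem_poly hf a.2⟩
  map_add' a b := Subtype.ext <| by simp
  map_smul' c a := Subtype.ext <| by simp

theorem coinverseOfOp_polyU (hf : ∀ i j, f (G.u i j) = op (G.u j i)) (i j : Fin N) :
    coinverseOfOp f hf (G.polyU i j) = G.polyU j i :=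
  Subtype.ext <| congrArg unop (hf i j)

theorem isQuantumSubgroup_of_op [Nontrivial G.A] (hu : IsOrthogonal G.u)
    (hdense : Dense (G.poly : Set G.A))
    (hcomul : ∃ Δ : G.A →⋆ₐ[ℂ] SpatialTensor G.A G.A, ∀ i j, Δ (G.u i j) = G.comulMatrix i j)
    (hf : ∀ i j, f (G.u i j) = op (G.u j i)) : G.IsQuantumSubgroup where
  nontrivial := inferInstance
  selfAdjoint := hu.star_eq
  mul_transpose := hu.mul_transpose
  transpose_mul := hu.transpose_mul
  dense := hdense
  comul := hcomul.imp fun _ hΔ i j => (hΔ i j).trans (G.comulMatrix_apply i j)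
  coinverse := by
    refine ⟨coinverseOfOp f hf, fun a b => Subtype.ext ?_, fun a => Subtype.ext ?_,
      fun i j => Subtype.ext ?_, fun i j => Subtype.ext ?_⟩
    · simp [coinverseOfOp]
    · simp [coinverseOfOp, map_star, unop_unop_of_mem_poly hf a.2]
    · simp only [coinverseOfOp_polyU, AddSubmonoidClass.coe_finsetSum, MulMemClass.coe_mul]
      exact (hu.sum_col i j).trans (by split_ifs <;> rfl)
    · simp only [coinverseOfOp_polyU, AddSubmonoidClass.coe_finsetSum, MulMemClass.coe_mul]
      exact (hu.sum_row i j).trans (by split_ifs <;> rfl)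

end CoordAlgebra

/-! ### The free hyperoctahedral group -/

section FreeHyperoctahedral

variable (N) in
/-- The canonical ⋆-homomorphism from the free ⋆-algebra onto the polynomial functions on
`H_N⁺`. -/
abbrev freeHyperoctahedralMk :
    FreeStarAlgebra (Fin N × Fin N) →⋆ₐ[ℂ] (freeHyperoctahedralGroup N).A :=
  UniversalCStarAlgebra.mk (orthogonalRelations N ∪ cubicRelations N)

theorem freeHyperoctahedralMk_ugen (i j : Fin N) :
    freeHyperoctahedralMk N (ugen i j) = (freeHyperoctahedralGroup N).u i j := rfl

theorem freeHyperoctahedralMk_eq_zero {r : FreeStarAlgebra (Fin N × Fin N)}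
    (hr : r ∈ orthogonalRelations N ∪ cubicRelations N) : freeHyperoctahedralMk N r = 0 :=
  UniversalCStarAlgebra.mk_eq_zero hr

theorem isOrthogonal_freeHyperoctahedralGroup :
    IsOrthogonal (freeHyperoctahedralGroup N).u where
  star_eq i j := by rw [← freeHyperoctahedralMk_ugen, ← map_star, ugen, star_gen]
  mul_transpose := by
    ext i j
    have h := freeHyperoctahedralMk_eq_zero (.inl (.inl ⟨i, j, rfl⟩))
    rw [map_sub, sub_eq_zero, map_sum, apply_ite (freeHyperoctahedralMk N), map_one, map_zero] at h
    simpa only [Matrix.mul_apply, Matrix.one_apply, map_mul] using! h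
  transpose_mul := by
    ext i j
    have h := freeHyperoctahedralMk_eq_zero (.inl (.inr ⟨i, j, rfl⟩))
    rw [map_sub, sub_eq_zero, map_sum, apply_ite (freeHyperoctahedralMk N), map_one, map_zero] at h
    simpa only [Matrix.mul_apply, Matrix.one_apply, map_mul] using! h

variable (N) in
theorem isCubic_freeHyperoctahedralGroup : IsCubic (freeHyperoctahedralGroup N).u where
  toIsOrthogonal := isOrthogonal_freeHyperoctahedralGroup
  mul_row i j k h := by
    simp only [← freeHyperoctahedralMk_ugen, ← map_mul]
    exact freeHyperoctahedralMk_eq_zero (.inr (.inl ⟨i, j, k, h, rfl⟩))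
  mul_col k h := by
    simp only [← freeHyperoctahedralMk_ugen, ← map_mul]
    exact freeHyperoctahedralMk_eq_zero (.inr (.inr ⟨k, _, _, h, rfl⟩))

theorem IsCubic.exists_lift {B : Type v} [CStarAlgebra B] {v : Matrix (Fin N) (Fin N) B}
    (hv : IsCubic v) : ∃ f : (freeHyperoctahedralGroup N).A →⋆ₐ[ℂ] B,
      ∀ i j, f ((freeHyperoctahedralGroup N).u i j) = v i j := by
  have hself (p : Fin N × Fin N) : star (v p.1 p.2) = v p.1 p.2 := hv.star_eq _ _
  have hgen (i j) : FreeStarAlgebra.lift (fun p => v p.1 p.2) hself (ugen i j) = v i j :=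
    FreeStarAlgebra.lift_gen _ hself (i, j)
  have hrel : ∀ r ∈ orthogonalRelations N ∪ cubicRelations N,
      FreeStarAlgebra.lift (fun p => v p.1 p.2) hself r = 0 := by
    rintro r ((⟨i, j, rfl⟩ | ⟨i, j, rfl⟩) | (⟨i, j, k, h, rfl⟩ | ⟨i, j, k, h, rfl⟩))
    · simp only [map_sub, map_sum, map_mul, hgen, hv.sum_row]
      split_ifs <;> simp
    · simp only [map_sub, map_sum, map_mul, hgen, hv.sum_col]
      split_ifs <;> simp
    · rw [map_mul, hgen, hgen, hv.mul_row i h]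
    · rw [map_mul, hgen, hgen, hv.mul_col i h]
  obtain ⟨f, hf⟩ :=
    UniversalCStarAlgebra.exists_lift hself (fun p => hv.norm_le_one p.1 p.2) hrel
  exact ⟨f, fun i j => hf (i, j)⟩

theorem dense_poly_freeHyperoctahedralGroup :
    Dense ((freeHyperoctahedralGroup N).poly : Set (freeHyperoctahedralGroup N).A) := by
  refine (UniversalCStarAlgebra.dense_adjoin_mk_gen _).mono (StarAlgebra.adjoin_le ?_)
  rintro _ ⟨⟨i, j⟩, rfl⟩
  exact (freeHyperoctahedralGroup N).u_mem_poly i j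

variable (N) in
theorem isQuantumSubgroup_freeHyperoctahedralGroup :
    (freeHyperoctahedralGroup N).IsQuantumSubgroup := by
  have hu := isCubic_freeHyperoctahedralGroup N
  obtain ⟨ε, -⟩ := (IsCubic.one (n := Fin N) (R := ℂ)).exists_lift
  have : Nontrivial (freeHyperoctahedralGroup N).A :=
    (ε : (freeHyperoctahedralGroup N).A →+* ℂ).domain_nontrivial
  obtain ⟨f, hf⟩ := hu.map_op.transpose.exists_lift
  exact isQuantumSubgroup_of_op hu.toIsOrthogonal dense_poly_freeHyperoctahedralGroup
    (isCubic_comulMatrix hu).exists_lift hf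

end FreeHyperoctahedral

/-! ### Gelfand duality and compact groups of matrices -/

section Gelfand

open WeakDual.CharacterSpace in
theorem exists_eq_eval {X : Type u} [TopologicalSpace X] [CompactSpace X] [T2Space X]
    (χ : C(X, ℂ) →ₐ[ℂ] ℂ) : ∃ x, ∀ f, χ f = f x := by
  obtain ⟨x, hx⟩ := (homeoEval X ℂ).surjective (equivAlgHom.symm χ)
  exact ⟨x, fun f => (DFunLike.congr_fun hx f).symm⟩

theorem exists_stmul_eq_mul_eval {X : Type u} [TopologicalSpace X] [CompactSpace X] [T2Space X]
    {Y : Type v} [TopologicalSpace Y] [CompactSpace Y] [T2Space Y]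
    (χ : SpatialTensor C(X, ℂ) C(Y, ℂ) →ₐ[ℂ] ℂ) :
    ∃ x y, ∀ f g, χ (stmul f g) = f x * g y := by
  obtain ⟨x, hx⟩ := exists_eq_eval (χ.comp (stmulOne : _ →⋆ₐ[ℂ] _).toAlgHom)
  obtain ⟨y, hy⟩ := exists_eq_eval (χ.comp (oneStmul : _ →⋆ₐ[ℂ] _).toAlgHom)
  refine ⟨x, y, fun f g => ?_⟩
  rw [← stmulOne_mul_oneStmul, map_mul]
  exact congrArg₂ (· * ·) (hx f) (hy g)

theorem exists_ofReal_eq_of_star_eq {B : Type v} [CStarAlgebra B] (χ : B →ₐ[ℂ] ℂ) {b : B}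
    (hb : star b = b) : ∃ r : ℝ, (r : ℂ) = χ b := by
  have := AlgHomClass.instStarHomClass (F := B →ₐ[ℂ] ℂ) (A := B)
  refine ⟨(χ b).re, Complex.conj_eq_iff_re.1 ?_⟩
  rw [starRingEnd_apply, ← map_star, hb]

variable {S : Set (Matrix (Fin N) (Fin N) ℝ)} [CompactSpace S]

open WeakDual.CharacterSpace in
theorem exists_lift_ofMatrices {B : Type v} [CommCStarAlgebra B] {w : Matrix (Fin N) (Fin N) B}
    (hw : ∀ χ : B →ₐ[ℂ] ℂ, ∃ U ∈ S, ∀ i j, χ (w i j) = (U i j : ℂ)) :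
    ∃ f : (ofMatrices S).A →⋆ₐ[ℂ] B, ∀ i j, f ((ofMatrices S).u i j) = w i j := by
  choose U hUS hU using hw
  have hcont : Continuous fun χ : WeakDual.characterSpace ℂ B => U (equivAlgHom χ) := by
    refine continuous_matrix fun i j => ?_
    have hre (χ : WeakDual.characterSpace ℂ B) : U (equivAlgHom χ) i j = (χ (w i j)).re :=
      (congrArg Complex.re (hU (equivAlgHom χ) i j)).symm
    simp only [hre]
    exact Complex.continuous_re.comp (gelfandStarTransform B (w i j)).continuous
  let θ : C(WeakDual.characterSpace ℂ B, S) :=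
    ⟨fun χ => ⟨U (equivAlgHom χ), hUS _⟩, hcont.subtype_mk _⟩
  refine ⟨StarAlgHom.comp ((gelfandStarTransform B).symm : _ →⋆ₐ[ℂ] B)
    (ContinuousMap.compStarAlgHom' ℂ ℂ θ), fun i j => (gelfandStarTransform B).injective
      (((gelfandStarTransform B).apply_symm_apply _).trans ?_)⟩
  ext χ
  exact (hU (equivAlgHom χ) i j).symm

theorem exists_lift_ofMatrices_of_mul_comm {B : Type v} [CStarAlgebra B]
    (hB : ∀ a b : B, a * b = b * a) {w : Matrix (Fin N) (Fin N) B}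
    (hw : ∀ χ : B →ₐ[ℂ] ℂ, ∃ U ∈ S, ∀ i j, χ (w i j) = (U i j : ℂ)) :
    ∃ f : (ofMatrices S).A →⋆ₐ[ℂ] B, ∀ i j, f ((ofMatrices S).u i j) = w i j :=
  let : CommCStarAlgebra B := { ‹CStarAlgebra B› with mul_comm := hB }
  exists_lift_ofMatrices hw

theorem IsOrthogonal.exists_ofReal_map_eq {n : Type*} [Fintype n] [DecidableEq n] {B : Type v}
    [CStarAlgebra B] {w : Matrix n n B} (hw : IsOrthogonal w) (χ : B →ₐ[ℂ] ℂ) :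
    ∃ U : Matrix n n ℝ, IsOrthogonal U ∧ ∀ i j, χ (w i j) = (U i j : ℂ) := by
  have := AlgHomClass.instStarHomClass (F := B →ₐ[ℂ] ℂ) (A := B)
  choose U hU using fun i j => exists_ofReal_eq_of_star_eq χ (hw.star_eq i j)
  have hχ : Matrix.map (Matrix.of U) (StarAlgHom.ofId ℝ ℂ) = w.map χ := Matrix.ext hU
  exact ⟨.of U, .of_map (f := StarAlgHom.ofId ℝ ℂ) Complex.ofReal_injective (hχ ▸ hw.map χ),
    fun i j => (hU i j).symm⟩

end Gelfand

section OfMatrices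

variable {S : Set (Matrix (Fin N) (Fin N) ℝ)} [CompactSpace S]

theorem exists_comul_ofMatrices (hmul : ∀ U ∈ S, ∀ V ∈ S, U * V ∈ S) :
    ∃ Δ : (ofMatrices S).A →⋆ₐ[ℂ] SpatialTensor (ofMatrices S).A (ofMatrices S).A,
      ∀ i j, Δ ((ofMatrices S).u i j) = (ofMatrices S).comulMatrix i j := by
  refine exists_lift_ofMatrices_of_mul_comm (B := SpatialTensor (ofMatrices S).A (ofMatrices S).A)
    (SpatialTensor.mul_comm (A := C(S, ℂ)) (B := C(S, ℂ))) fun χ => ?_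
  obtain ⟨U, V, hχ⟩ := exists_stmul_eq_mul_eval (X := S) (Y := S) χ
  refine ⟨U.1 * V.1, hmul _ U.2 _ V.2, fun i j => ?_⟩
  simp only [comulMatrix_apply, map_sum, Matrix.mul_apply, Complex.ofReal_sum, Complex.ofReal_mul]
  exact Finset.sum_congr rfl fun k _ => hχ _ _

theorem dense_poly_ofMatrices : Dense ((ofMatrices S).poly : Set (ofMatrices S).A) := by
  have hsep : (ofMatrices S).poly.toSubalgebra.SeparatesPoints := by
    intro U V hUV
    obtain ⟨i, j, hij⟩ : ∃ i j, U.1 i j ≠ V.1 i j := by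
      by_contra! h
      exact hUV (Subtype.ext (Matrix.ext h))
    exact ⟨_, ⟨(ofMatrices S).u i j, (ofMatrices S).u_mem_poly i j, rfl⟩,
      fun h => hij (Complex.ofReal_injective h)⟩
  exact fun _ => (ContinuousMap.starSubalgebra_topologicalClosure_eq_top_of_separatesPoints
    (X := S) (𝕜 := ℂ) _ hsep).ge trivial

theorem isOrthogonal_ofMatrices (hO : S ⊆ orthogonalMatrices N) :
    IsOrthogonal (ofMatrices S).u :=
  .of_forall_eval (X := S) (R := ℂ) fun U =>
    (mem_orthogonalMatrices_iff.1 (hO U.2)).map (StarAlgHom.ofId ℝ ℂ)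

theorem isQuantumSubgroup_ofMatrices (hne : S.Nonempty) (hO : S ⊆ orthogonalMatrices N)
    (hmul : ∀ U ∈ S, ∀ V ∈ S, U * V ∈ S) (htr : ∀ U ∈ S, U.transpose ∈ S) :
    (ofMatrices S).IsQuantumSubgroup := by
  have := hne.to_subtype
  have : Nontrivial (ofMatrices S).A := inferInstanceAs (Nontrivial C(S, ℂ))
  let τ : C(S, S) := ⟨fun U => ⟨U.1.transpose, htr _ U.2⟩, by fun_prop⟩
  let f : C(S, ℂ) →⋆ₐ[ℂ] C(S, ℂ)ᵐᵒᵖ :=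
    { toFun g := MulOpposite.op (g.comp τ)
      map_one' := rfl
      map_mul' a b := congrArg MulOpposite.op (mul_comm (a.comp τ) (b.comp τ))
      map_zero' := rfl
      map_add' _ _ := rfl
      commutes' _ := rfl
      map_star' _ := rfl }
  exact isQuantumSubgroup_of_op (f := f) (isOrthogonal_ofMatrices hO) dense_poly_ofMatrices
    (exists_comul_ofMatrices hmul) fun _ _ => rfl

theorem actsAffinely_ofMatrices {X : Set (EuclideanSpace ℝ (Fin N))} [CompactSpace X]
    (h : ∀ U ∈ S, Set.MapsTo (Matrix.toEuclideanLin U) X X) : (ofMatrices S).ActsAffinely X := by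
  have hcont : Continuous fun p : X × S => Matrix.toEuclideanLin p.2.1 p.1.1 :=
    (PiLp.continuous_toLp 2 _).comp <|
      Continuous.matrix_mulVec (A := fun p : X × S => p.2.1) (by fun_prop) (by fun_prop)
  let m : C(X × S, X) :=
    ⟨fun p => ⟨Matrix.toEuclideanLin p.2.1 p.1.1, h _ p.2.2 p.1.2⟩, hcont.subtype_mk _⟩
  let Φ : C(X, ℂ) →⋆ₐ[ℂ] C(X, C(S, ℂ)) :=
    { toFun f := (f.comp m).curry
      map_one' := rfl
      map_mul' _ _ := rfl
      map_zero' := rfl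
      map_add' _ _ := rfl
      commutes' _ := rfl
      map_star' _ := rfl }
  refine ⟨Φ, fun i => ContinuousMap.ext fun x => ContinuousMap.ext fun U => ?_⟩
  rw [ContinuousMap.sum_apply]
  refine Eq.trans ?_ (ContinuousMap.sum_apply (α := S) (β := ℂ) _ _ U).symm
  change ((∑ j, U.1 i j * x.1 j : ℝ) : ℂ) = ∑ j, (x.1 j : ℂ) * (U.1 i j : ℂ)
  simp only [Complex.ofReal_sum, Complex.ofReal_mul, mul_comm]

end OfMatrices

/-! ### Orthogonal matrices preserving a polygonal sphere -/

section Sphere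

open Matrix (toEuclideanLin)

variable {d : ℕ} {x : EuclideanSpace ℝ (Fin N)} {U : Matrix (Fin N) (Fin N) ℝ}

theorem mem_polygonalSphere_iff :
    x ∈ polygonalSphere N d ↔ ‖x‖ = 1 ∧ (Finset.univ.filter fun i => x i ≠ 0).card ≤ d := by
  rw [← mem_sphere_zero_iff_norm]
  refine and_congr_right fun _ => ⟨fun h => ?_, fun h i => ?_⟩
  · by_contra! hc
    refine Finset.prod_ne_zero_iff.2 (fun a _ => ?_)
      (h (Finset.orderEmbOfCardLe _ (Nat.succ_le_of_lt hc)).toEmbedding)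
    exact (Finset.mem_filter.1 (Finset.orderEmbOfCardLe_mem _ (Nat.succ_le_of_lt hc) a)).2
  · by_contra hne
    have hsub : Finset.univ.map i ⊆ Finset.univ.filter fun i => x i ≠ 0 := fun b hb => by
      obtain ⟨a, -, rfl⟩ := Finset.mem_map.1 hb
      exact Finset.mem_filter.2
        ⟨Finset.mem_univ _, Finset.prod_ne_zero_iff.1 hne a (Finset.mem_univ a)⟩
    have hcard := (Finset.card_le_card hsub).trans h
    rw [Finset.card_map, Finset.card_univ, Fintype.card_fin] at hcard
    exact Nat.not_succ_le_self d hcard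

theorem mem_polygonalSphere_of_support_subset {A : Finset (Fin N)} (hx : ‖x‖ = 1)
    (hA : A.card ≤ d) (hxA : ∀ i ∉ A, x i = 0) : x ∈ polygonalSphere N d :=
  mem_polygonalSphere_iff.2 ⟨hx, (Finset.card_le_card fun i hi => by
    by_contra hiA
    exact (Finset.mem_filter.1 hi).2 (hxA i hiA)).trans hA⟩

theorem normalize_mem_polygonalSphere {A : Finset (Fin N)} (hx : x ≠ 0) (hA : A.card ≤ d)
    (hxA : ∀ i ∉ A, x i = 0) : ‖x‖⁻¹ • x ∈ polygonalSphere N d :=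
  mem_polygonalSphere_of_support_subset (norm_smul_inv_norm (𝕜 := ℝ) hx) hA fun i hi => by
    rw [PiLp.smul_apply, hxA i hi, smul_zero]

theorem IsOrthogonal.norm_toEuclideanLin (hU : IsOrthogonal U) (x : EuclideanSpace ℝ (Fin N)) :
    ‖toEuclideanLin U x‖ = ‖x‖ := by
  have h : U.mulVec x ⬝ᵥ U.mulVec x = x.ofLp ⬝ᵥ x.ofLp := by
    rw [Matrix.dotProduct_mulVec, Matrix.vecMul_mulVec, hU.transpose_mul, Matrix.vecMul_one]
  rw [← sq_eq_sq₀ (norm_nonneg _) (norm_nonneg _), EuclideanSpace.real_norm_sq_eq,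
    EuclideanSpace.real_norm_sq_eq]
  simpa only [dotProduct, sq] using! h

theorem IsOrthogonal.mapsTo_polygonalSphere_self (hU : IsOrthogonal U) :
    Set.MapsTo (toEuclideanLin U) (polygonalSphere N N) (polygonalSphere N N) := fun x hx =>
  mem_polygonalSphere_of_support_subset (A := Finset.univ)
    ((hU.norm_toEuclideanLin x).trans (mem_polygonalSphere_iff.1 hx).1) (by simp) (by simp)

theorem mapsTo_polygonalSphere_of_mem_signedPermutations (hU : U ∈ signedPermutations N) :
    Set.MapsTo (toEuclideanLin U) (polygonalSphere N d) (polygonalSphere N d) := by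
  intro x hx
  have hnorm := (isCubic_of_mem_signedPermutations hU).toIsOrthogonal.norm_toEuclideanLin x
  obtain ⟨⟨σ, ε⟩, rfl⟩ := hU
  refine ⟨mem_sphere_zero_iff_norm.2 (hnorm.trans (mem_sphere_zero_iff_norm.1 hx.1)), fun i => ?_⟩
  have happly (k) : toEuclideanLin (.of fun i j => if j = σ i then ((ε i : ℤ) : ℝ) else 0) x k =
      ((ε k : ℤ) : ℝ) * x (σ k) := by
    simp [Matrix.mulVec, dotProduct]
  simp only [happly, Finset.prod_mul_distrib]
  rw [show ∏ a, x (σ (i a)) = 0 from hx.2 (i.trans σ.toEmbedding), mul_zero]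

theorem single_mem_polygonalSphere (hd : 1 ≤ d) (j : Fin N) {ε : ℝ} (hε : |ε| = 1) :
    EuclideanSpace.single j ε ∈ polygonalSphere N d :=
  mem_polygonalSphere_of_support_subset (A := {j}) (by simpa using hε) (by simpa using hd)
    fun i hi => by simp [Finset.notMem_singleton.1 hi]

theorem exists_eq_single_of_mem_polygonalSphere_one (hx : x ∈ polygonalSphere N 1) :
    ∃ (j : Fin N) (ε : ℤˣ), x = EuclideanSpace.single j ((ε : ℤ) : ℝ) := by
  obtain ⟨hnorm, hcard⟩ := mem_polygonalSphere_iff.1 hx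
  obtain ⟨j, hj⟩ : ∃ j, x j ≠ 0 := by
    by_contra! h
    have : x = 0 := PiLp.ext h
    simp [this] at hnorm
  have hx : x = EuclideanSpace.single j (x j) := by
    ext i
    obtain rfl | hij := eq_or_ne i j
    · simp
    · have : x i = 0 := by
        by_contra hi
        exact hij (Finset.card_le_one.1 hcard i (by simpa using hi) j (by simpa using hj))
      simp [hij, this]
  rw [hx, PiLp.norm_single, Real.norm_eq_abs] at hnorm
  obtain h | h := eq_or_eq_neg_of_abs_eq hnorm
  · exact ⟨j, 1, by rw [hx, h]; simp⟩
  · exact ⟨j, -1, by rw [hx, h]; simp⟩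

open Classical in
/-- The rows in which some column belonging to `A` has a nonzero entry. -/
def rowSupport (U : Matrix (Fin N) (Fin N) ℝ) (A : Finset (Fin N)) : Finset (Fin N) :=
  Finset.univ.filter fun i => ∃ j ∈ A, U i j ≠ 0

theorem mem_rowSupport {A : Finset (Fin N)} {i : Fin N} :
    i ∈ rowSupport U A ↔ ∃ j ∈ A, U i j ≠ 0 := by
  simp [rowSupport]

-- A finite union of proper subspaces is proper, so a generic combination of the columns in `A`
-- vanishes in no row that can be nonzero.
theorem exists_mulVec_ne_zero (U : Matrix (Fin N) (Fin N) ℝ) (A : Finset (Fin N)) :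
    ∃ v : Fin N → ℝ, (∀ j ∉ A, v j = 0) ∧ ∀ i ∈ rowSupport U A, U.mulVec v i ≠ 0 := by
  let p : Submodule ℝ (Fin N → ℝ) := Submodule.pi (↑Aᶜ) fun _ => ⊥
  let f (i : rowSupport U A) : Module.Dual ℝ (Fin N → ℝ) := .comp (.proj i.1) U.mulVecLin
  obtain ⟨v, hvp, hv⟩ := Module.Dual.exists_forall_mem_ne_zero_of_forall_exists p f fun i => by
    obtain ⟨j, hj, hij⟩ := mem_rowSupport.1 i.2
    refine ⟨Pi.single j 1, fun k hk => ?_, by simpa [f] using hij⟩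
    have hkj : k ≠ j := fun h => Finset.mem_compl.1 hk (h ▸ hj)
    exact Pi.single_eq_of_ne hkj 1
  exact ⟨v, fun j hj => hvp j (Finset.mem_compl.2 hj), fun i hi => hv ⟨i, hi⟩⟩

theorem card_rowSupport_le
    (hU : Set.MapsTo (toEuclideanLin U) (polygonalSphere N d) (polygonalSphere N d))
    {A : Finset (Fin N)} (hA : A.card ≤ d) : (rowSupport U A).card ≤ d := by
  obtain hempty | ⟨i₀, hi₀⟩ := (rowSupport U A).eq_empty_or_nonempty
  · simp [hempty]
  obtain ⟨v, hvA, hv⟩ := exists_mulVec_ne_zero U A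
  have hv_ne : WithLp.toLp 2 v ≠ 0 := fun h => hv i₀ hi₀ (by
    rw [show v = 0 from congrArg WithLp.ofLp h, Matrix.mulVec_zero, Pi.zero_apply])
  have hy := hU (normalize_mem_polygonalSphere hv_ne hA hvA)
  refine (Finset.card_le_card fun i hi => ?_).trans (mem_polygonalSphere_iff.1 hy).2
  refine Finset.mem_filter.2 ⟨Finset.mem_univ _, ?_⟩
  rw [map_smul]
  exact mul_ne_zero (inv_ne_zero (norm_ne_zero_iff.2 hv_ne)) (hv i hi)

theorem IsOrthogonal.sum_rowSupport_compl (hU : IsOrthogonal U) (A : Finset (Fin N)) :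
    ∑ i ∈ rowSupport U A, ∑ k ∈ Aᶜ, U i k * U i k = (rowSupport U A).card - A.card := by
  have hcols : ∑ i ∈ rowSupport U A, ∑ j ∈ A, U i j * U i j = A.card := by
    rw [Finset.sum_comm, Finset.cast_card]
    refine Finset.sum_congr rfl fun j hj => ?_
    rw [Finset.sum_subset (Finset.subset_univ _) fun i _ hi => ?_, hU.sum_col, if_pos rfl]
    by_contra h
    exact hi (mem_rowSupport.2 ⟨j, hj, fun h0 => h (by rw [h0, zero_mul])⟩)
  have hrows : ∑ i ∈ rowSupport U A, ∑ j, U i j * U i j = (rowSupport U A).card := by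
    rw [Finset.cast_card]
    exact Finset.sum_congr rfl fun i _ => (hU.sum_row i i).trans (if_pos rfl)
  rw [← hcols, ← hrows, ← Finset.sum_sub_distrib]
  exact Finset.sum_congr rfl fun i _ => eq_sub_of_add_eq' (Finset.sum_add_sum_compl A _)

theorem IsOrthogonal.eq_zero_of_mem_rowSupport (hU : IsOrthogonal U) {A : Finset (Fin N)}
    (hA : (rowSupport U A).card ≤ A.card) {i k : Fin N} (hi : i ∈ rowSupport U A) (hk : k ∉ A) :
    U i k = 0 := by
  have hnonneg (i) : 0 ≤ ∑ k ∈ Aᶜ, U i k * U i k :=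
    Finset.sum_nonneg fun k _ => mul_self_nonneg _
  have hsum : ∑ i ∈ rowSupport U A, ∑ k ∈ Aᶜ, U i k * U i k = 0 := by
    refine le_antisymm ?_ (Finset.sum_nonneg fun i _ => hnonneg i)
    rw [hU.sum_rowSupport_compl, sub_nonpos]
    exact_mod_cast hA
  have hrow := (Finset.sum_eq_zero_iff_of_nonneg fun i _ => hnonneg i).1 hsum i hi
  exact mul_self_eq_zero.1 <| (Finset.sum_eq_zero_iff_of_nonneg fun k _ => mul_self_nonneg _).1
    hrow k (Finset.mem_compl.2 hk)

theorem IsOrthogonal.mem_signedPermutations_of_mapsTo (hU : IsOrthogonal U) (hd : 1 ≤ d)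
    (hdN : d < N)
    (hmaps : Set.MapsTo (toEuclideanLin U) (polygonalSphere N d) (polygonalSphere N d)) :
    U ∈ signedPermutations N := by
  refine hU.mem_signedPermutations fun i j k hjk => ?_
  obtain ⟨A, hjA, hAk, hA⟩ := Finset.exists_subsuperset_card_eq (s := {j})
    (t := Finset.univ.erase k) (n := d) (by simpa using hjk) (by simpa using hd)
    (by simpa using Nat.le_sub_one_of_lt hdN)
  have hk : k ∉ A := fun hk => (Finset.mem_erase.1 (hAk hk)).1 rfl
  by_cases hij : U i j = 0
  · rw [hij, zero_mul]
  · have hi : i ∈ rowSupport U A := mem_rowSupport.2 ⟨j, Finset.singleton_subset_iff.1 hjA, hij⟩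
    rw [hU.eq_zero_of_mem_rowSupport (hA.symm ▸ card_rowSupport_le hmaps hA.le) hi hk, mul_zero]

end Sphere

/-! ### Consequences of an affine action -/

namespace CoordAlgebra

variable {H : CoordAlgebra.{u} N} {X : Set (EuclideanSpace ℝ (Fin N))} {d : ℕ}

/-- The inverse of an orthogonal matrix is its transpose, so the coinverse transposes `u`. -/
theorem IsQuantumSubgroup.exists_antipode (hH : H.IsQuantumSubgroup) :
    ∃ κ : H.poly →ₗ[ℂ] H.poly, (∀ a b, κ (a * b) = κ b * κ a) ∧
      ∀ i j, κ (H.polyU i j) = H.polyU j i := by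
  obtain ⟨κ, hmul, -, hκ, -⟩ := hH.coinverse
  let P : Matrix (Fin N) (Fin N) H.poly := .of H.polyU
  have hP : IsOrthogonal P :=
    .of_map (f := H.poly.subtype) Subtype.val_injective hH.isOrthogonal
  have hleft : P.map κ * P = 1 := Matrix.ext fun i j => (hκ i j).trans Matrix.one_apply.symm
  have hPκ : P.map κ = P.transpose := left_inv_eq_right_inv hleft hP.mul_transpose
  exact ⟨κ, hmul, congrFun₂ hPκ⟩

section MulVec

/-- The entries `∑ j, u_ij x_j` of the vector `u x`, for the matrix `u` of coordinates. -/
def mulVec (H : CoordAlgebra.{u} N) (x : EuclideanSpace ℝ (Fin N)) (i : Fin N) : H.A :=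
  ∑ j, (x j : ℂ) • H.u i j

theorem mulVec_single (j : Fin N) (ε : ℝ) (i : Fin N) :
    H.mulVec (.single j ε) i = (ε : ℂ) • H.u i j := by
  rw [mulVec, Finset.sum_eq_single j (fun l _ hl => by simp [hl]) (by simp)]
  simp

theorem mulVec_add (x y : EuclideanSpace ℝ (Fin N)) (i : Fin N) :
    H.mulVec (x + y) i = H.mulVec x i + H.mulVec y i := by
  simp [mulVec, add_smul, Finset.sum_add_distrib]

theorem mulVec_smul (c : ℝ) (x : EuclideanSpace ℝ (Fin N)) (i : Fin N) :
    H.mulVec (c • x) i = (c : ℂ) • H.mulVec x i := by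
  simp [mulVec, mul_smul, Finset.smul_sum]

theorem ActsAffinely.exists_eval [CompactSpace X] (h : H.ActsAffinely X)
    {x : EuclideanSpace ℝ (Fin N)} (hx : x ∈ X) :
    ∃ φ : C(X, ℂ) →⋆ₐ[ℂ] H.A, ∀ i, φ (coordFun X i) = H.mulVec x i := by
  obtain ⟨Φ, hΦ⟩ := h
  let ev : C(X, H.A) →⋆ₐ[ℂ] H.A :=
    { toFun := fun f => f ⟨x, hx⟩
      map_one' := rfl
      map_mul' := fun _ _ => rfl
      map_zero' := rfl
      map_add' := fun _ _ => rfl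
      commutes' := fun _ => rfl
      map_star' := fun _ => rfl }
  refine ⟨ev.comp Φ, fun i => ?_⟩
  change Φ (coordFun X i) ⟨x, hx⟩ = _
  rw [hΦ]
  exact ContinuousMap.sum_apply ..

theorem ActsAffinely.commute_mulVec [CompactSpace X] (h : H.ActsAffinely X)
    {x : EuclideanSpace ℝ (Fin N)} (hx : x ∈ X) (i k : Fin N) :
    Commute (H.mulVec x i) (H.mulVec x k) := by
  obtain ⟨φ, hφ⟩ := h.exists_eval hx
  rw [← hφ, ← hφ]
  exact (Commute.all _ _).map φ

theorem ActsAffinely.commute_mulVec_of_support_subset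
    (h : H.ActsAffinely (polygonalSphere N d)) {A : Finset (Fin N)} (hA : A.card ≤ d)
    {x : EuclideanSpace ℝ (Fin N)} (hxA : ∀ i ∉ A, x i = 0) (i k : Fin N) :
    Commute (H.mulVec x i) (H.mulVec x k) := by
  obtain rfl | hx := eq_or_ne x 0
  · simp [mulVec]
  have hc : ((‖x‖⁻¹ : ℝ) : ℂ) ≠ 0 :=
    Complex.ofReal_ne_zero.2 (inv_ne_zero (norm_ne_zero_iff.2 hx))
  simpa only [mulVec_smul, Commute.smul_left_iff₀ hc, Commute.smul_right_iff₀ hc] using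
    h.commute_mulVec (normalize_mem_polygonalSphere hx hA hxA) i k

end MulVec

section Commutativity

attribute [local instance] LieRing.ofAssociativeRing

-- Polarization of `⁅(u x)_i, (u x)_k⁆ = 0` at `x = e_j + e_l`.
theorem ActsAffinely.lie_add_lie (hd : 2 ≤ d) (hA : H.ActsAffinely (polygonalSphere N d))
    (i j k l : Fin N) : ⁅H.u i j, H.u k l⁆ + ⁅H.u i l, H.u k j⁆ = 0 := by
  have hsame (j) : ⁅H.u i j, H.u k j⁆ = 0 := by
    have := hA.commute_mulVec (single_mem_polygonalSphere (one_le_two.trans hd) j abs_one) i k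
    simpa only [mulVec_single, Complex.ofReal_one, one_smul] using this.lie_eq
  have hsum := hA.commute_mulVec_of_support_subset (A := {j, l}) (Finset.card_le_two.trans hd)
    (x := .single j 1 + .single l 1) (fun m hm => by
      simp only [Finset.mem_insert, Finset.mem_singleton, not_or] at hm
      simp [hm.1, hm.2]) i k
  simpa only [mulVec_add, mulVec_single, Complex.ofReal_one, one_smul, add_lie, lie_add, hsame,
    zero_add, add_zero, add_comm] using hsum.lie_eq

-- The antipode turns the previous identity into its transpose; the two differ by a sign in the
-- second commutator.
theorem IsQuantumSubgroup.commute_u (hH : H.IsQuantumSubgroup) (hd : 2 ≤ d)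
    (hA : H.ActsAffinely (polygonalSphere N d)) (i j k l : Fin N) :
    Commute (H.u i j) (H.u k l) := by
  obtain ⟨κ, hmul, hκ⟩ := hH.exists_antipode
  have hκ_lie (a b : H.poly) : κ ⁅a, b⁆ = ⁅κ b, κ a⁆ := by simp only [Ring.lie_def, map_sub, hmul]
  have hrow := hA.lie_add_lie hd i j k l
  have hcol : ⁅H.u i j, H.u k l⁆ + ⁅H.u k j, H.u i l⁆ = 0 := by
    have h : ⁅H.polyU l k, H.polyU j i⁆ + ⁅H.polyU l i, H.polyU j k⁆ = 0 :=
      Subtype.ext (hA.lie_add_lie hd l k j i)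
    have hκ_h := congrArg κ h
    simp only [map_add, map_zero, hκ_lie, hκ] at hκ_h
    exact congrArg Subtype.val hκ_h
  have htwo : (2 : ℂ) • ⁅H.u i j, H.u k l⁆ = 0 :=
    calc (2 : ℂ) • ⁅H.u i j, H.u k l⁆ = (⁅H.u i j, H.u k l⁆ + ⁅H.u i l, H.u k j⁆) +
          (⁅H.u i j, H.u k l⁆ + ⁅H.u k j, H.u i l⁆) := by simp only [Ring.lie_def]; module
      _ = 0 := by rw [hrow, hcol, add_zero]
  exact commute_iff_lie_eq.2 ((smul_eq_zero_iff_right two_ne_zero).1 htwo)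

theorem IsQuantumSubgroup.mul_comm_of_commute_u (hH : H.IsQuantumSubgroup)
    (h : ∀ i j k l, Commute (H.u i j) (H.u k l)) (a b : H.A) : a * b = b * a := by
  have hpoly : IsMulCommutative H.poly := StarAlgebra.isMulCommutative_adjoin ℂ
    (by rintro _ ⟨i, j, rfl⟩ _ ⟨k, l, rfl⟩; exact h i j k l)
    (by rintro _ ⟨i, j, rfl⟩ _ ⟨k, l, rfl⟩; rw [hH.selfAdjoint]; exact h i j k l)
  refine hH.dense.induction (P := fun b => a * b = b * a) (fun b hb => ?_)
    (isClosed_eq (by fun_prop) (by fun_prop)) b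
  refine hH.dense.induction (P := fun a => a * b = b * a) (fun a ha => ?_)
    (isClosed_eq (by fun_prop) (by fun_prop)) a
  exact congrArg Subtype.val (hpoly.is_comm.comm (⟨a, ha⟩ : H.poly) ⟨b, hb⟩)

theorem IsQuantumSubgroup.isSubgroupOf_ofMatrices (hH : H.IsQuantumSubgroup)
    (h : ∀ i j k l, Commute (H.u i j) (H.u k l)) [CompactSpace X] (hA : H.ActsAffinely X)
    {S : Set (Matrix (Fin N) (Fin N) ℝ)} [CompactSpace S]
    (hS : ∀ U, IsOrthogonal U → Set.MapsTo (Matrix.toEuclideanLin U) X X → U ∈ S) :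
    H.IsSubgroupOf (ofMatrices S) := by
  refine exists_lift_ofMatrices_of_mul_comm (hH.mul_comm_of_commute_u h) fun χ => ?_
  obtain ⟨U, hUo, hU⟩ := hH.isOrthogonal.exists_ofReal_map_eq χ
  refine ⟨U, hS U hUo fun x hx => ?_, hU⟩
  obtain ⟨φ, hφ⟩ := hA.exists_eval hx
  obtain ⟨y, hy⟩ := exists_eq_eval (χ.comp φ.toAlgHom)
  have hUx : Matrix.toEuclideanLin U x = y.1 := by
    ext i
    refine Complex.ofReal_injective (Eq.trans ?_ (hy (coordFun X i)))
    refine Eq.trans ?_ (congrArg χ (hφ i)).symm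
    simp only [mulVec, map_sum, map_smul, hU, smul_eq_mul, mul_comm, Matrix.toLpLin_apply,
      Matrix.mulVec, dotProduct, Complex.ofReal_sum, Complex.ofReal_mul]
  exact hUx ▸ y.2

end Commutativity

section Cubic

theorem ActsAffinely.mul_eq_zero (hA : H.ActsAffinely (polygonalSphere N 1)) {i j : Fin N}
    (k : Fin N) (hij : i ≠ j) : H.u i k * H.u j k = 0 := by
  obtain ⟨φ, hφ⟩ := hA.exists_eval (single_mem_polygonalSphere le_rfl k abs_one)
  simp only [mulVec_single, Complex.ofReal_one, one_smul] at hφ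
  have hcoord : coordFun (polygonalSphere N 1) i * coordFun (polygonalSphere N 1) j = 0 := by
    ext x
    obtain ⟨l, ε, hx⟩ := exists_eq_single_of_mem_polygonalSphere_one x.2
    obtain rfl | hil := eq_or_ne i l
    · simp [coordFun, hx, hij.symm]
    · simp [coordFun, hx, hil]
  rw [← hφ, ← hφ, ← map_mul, hcoord, map_zero]

theorem IsQuantumSubgroup.isCubic (hH : H.IsQuantumSubgroup)
    (hA : H.ActsAffinely (polygonalSphere N 1)) : IsCubic H.u where
  toIsOrthogonal := hH.isOrthogonal
  mul_row i j k hjk := by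
    obtain ⟨κ, hmul, hκ⟩ := hH.exists_antipode
    have h : H.polyU k i * H.polyU j i = 0 := Subtype.ext (hA.mul_eq_zero i hjk.symm)
    have hκ_h := congrArg κ h
    rw [hmul, hκ, hκ, map_zero] at hκ_h
    exact congrArg Subtype.val hκ_h
  mul_col k hij := hA.mul_eq_zero k hij

end Cubic

end CoordAlgebra

/-! ### The action of the free hyperoctahedral group on `{±e_i}` -/

section SpectralProjections

variable {A : Type u} [Ring A] [Algebra ℂ A]

/-- Evaluation at finitely many points with projections as weights: the ⋆-homomorphism
`f ↦ ∑ a, f (x a) e_a` out of `C(X)`, for self-adjoint idempotents `e_a` forming a partition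
of unity. -/
def projectionHom [StarRing A] [StarModule ℂ A] {X : Type v} [TopologicalSpace X] {ι : Type*}
    [Fintype ι] (x : ι → X) {e : ι → A} (he : CompleteOrthogonalIdempotents e)
    (hstar : ∀ a, star (e a) = e a) : C(X, ℂ) →⋆ₐ[ℂ] A where
  toFun f := ∑ a, f (x a) • e a
  map_one' := by simpa using he.complete
  map_mul' f g := by
    classical
    simp only [Finset.sum_mul_sum, smul_mul_smul_comm, he.mul_eq, smul_ite, smul_zero,
      Finset.sum_ite_eq, Finset.mem_univ, if_true, ContinuousMap.mul_apply]
  map_zero' := by simp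
  map_add' f g := by simp [add_smul, Finset.sum_add_distrib]
  commutes' c := by
    change ∑ a, c • e a = _
    rw [← Finset.smul_sum, he.complete, Algebra.algebraMap_eq_smul_one]
  map_star' f := by simp [star_sum, star_smul, hstar]

/-- The spectral projection `(w² + ε w) / 2` of a self-adjoint element `w` with `w³ = w`, for the
eigenvalue `ε = ±1`. -/
def spectralProjection (w : A) (ε : ℤˣ) : A := (1 / 2 : ℂ) • (w * w + ((ε : ℤ) : ℂ) • w)

theorem star_spectralProjection [StarRing A] [StarModule ℂ A] {w : A} (hw : star w = w)
    (ε : ℤˣ) : star (spectralProjection w ε) = spectralProjection w ε := by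
  simp [spectralProjection, hw]

theorem spectralProjection_one_add (w : A) :
    spectralProjection w 1 + spectralProjection w (-1) = w * w := by
  simp only [spectralProjection, Units.val_neg, Units.val_one, Int.cast_neg, Int.cast_one]
  module

theorem spectralProjection_one_sub (w : A) :
    spectralProjection w 1 - spectralProjection w (-1) = w := by
  simp only [spectralProjection, Units.val_neg, Units.val_one, Int.cast_neg, Int.cast_one]
  module

theorem spectralProjection_mul_eq_zero_of_ne {w : A} (hw : w * w * w = w) {ε δ : ℤˣ}
    (h : ε ≠ δ) : spectralProjection w ε * spectralProjection w δ = 0 := by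
  have hw' : w * (w * w) = w := by rw [← mul_assoc, hw]
  have hw_sq : w * w * (w * w) = w * w := by rw [mul_assoc, hw']
  obtain rfl := Int.units_ne_iff_eq_neg.1 h
  simp only [spectralProjection, add_mul, mul_add, mul_smul_comm, smul_mul_assoc, hw, hw', hw_sq]
  obtain rfl | rfl := Int.units_eq_one_or δ <;>
    simp only [Units.val_neg, Units.val_one, Int.cast_neg, Int.cast_one] <;> module

theorem spectralProjection_mul_eq_zero {v w : A} (h : v * w = 0) (ε δ : ℤˣ) :
    spectralProjection v ε * spectralProjection w δ = 0 := by
  have h₁ : v * (w * w) = 0 := by rw [← mul_assoc, h, zero_mul]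
  have h₂ : v * v * w = 0 := by rw [mul_assoc, h, mul_zero]
  have h₃ : v * v * (w * w) = 0 := by rw [mul_assoc, h₁, mul_zero]
  simp [spectralProjection, add_mul, mul_add, h, h₁, h₂, h₃]

theorem completeOrthogonalIdempotents_spectralProjection {ι : Type*} [Fintype ι] {w : ι → A}
    (hmul : ∀ i k, i ≠ k → w i * w k = 0) (hsum : ∑ i, w i * w i = 1) :
    CompleteOrthogonalIdempotents fun a : ι × ℤˣ => spectralProjection (w a.1) a.2 := by
  have hcube (i) : w i * w i * w i = w i := by
    have hzero (k) (hk : k ≠ i) : w k * w k * w i = 0 := by rw [mul_assoc, hmul k i hk, mul_zero]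
    rw [← Fintype.sum_eq_single i hzero, ← Finset.sum_mul, hsum, one_mul]
  refine CompleteOrthogonalIdempotents.iff_ortho_complete.2 ⟨?_, ?_⟩
  · rintro ⟨i, ε⟩ ⟨k, δ⟩ hne
    obtain rfl | hik := eq_or_ne i k
    · exact spectralProjection_mul_eq_zero_of_ne (hcube i) fun h =>
        hne (Prod.ext rfl h)
    · exact spectralProjection_mul_eq_zero (hmul i k hik) ε δ
  · rw [Fintype.sum_prod_type, ← hsum]
    refine Finset.sum_congr rfl fun i _ => ?_
    rw [UnitsInt.univ, Finset.sum_pair (by decide), spectralProjection_one_add]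

/-- The points `±e_i` of `S^{N-1,0}`. -/
def vertex (a : Fin N × ℤˣ) : polygonalSphere N 1 :=
  ⟨.single a.1 ((a.2 : ℤ) : ℝ), single_mem_polygonalSphere le_rfl _ (by
    obtain h | h := Int.units_eq_one_or a.2 <;> simp [h])⟩

theorem sum_coordFun_vertex_smul_spectralProjection (w : Fin N → A) (i : Fin N) :
    ∑ a, coordFun (polygonalSphere N 1) i (vertex a) • spectralProjection (w a.1) a.2 = w i := by
  have hcoord (a) : coordFun (polygonalSphere N 1) i (vertex a) =
      if i = a.1 then ((a.2 : ℤ) : ℂ) else 0 := by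
    simp only [coordFun, vertex, ContinuousMap.coe_mk, PiLp.single_apply]
    split_ifs <;> simp
  simp only [hcoord, ite_smul, zero_smul, Fintype.sum_prod_type]
  rw [Finset.sum_eq_single i (fun k _ hk => by simp [hk.symm]) (by simp),
    UnitsInt.univ, Finset.sum_pair (by decide)]
  simpa [sub_eq_add_neg] using spectralProjection_one_sub (w i)

end SpectralProjections

namespace CoordAlgebra

variable {G : CoordAlgebra.{u} N} {x : EuclideanSpace ℝ (Fin N)}

theorem star_mulVec (hG : IsOrthogonal G.u) (x : EuclideanSpace ℝ (Fin N)) (i : Fin N) :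
    star (G.mulVec x i) = G.mulVec x i := by
  simp [mulVec, star_sum, star_smul, hG.star_eq]

theorem exists_mulVec_eq_smul (G : CoordAlgebra.{u} N) (hx : x ∈ polygonalSphere N 1) :
    ∃ (j : Fin N) (ε : ℤˣ), ∀ i, G.mulVec x i = ((ε : ℤ) : ℂ) • G.u i j := by
  obtain ⟨j, ε, rfl⟩ := exists_eq_single_of_mem_polygonalSphere_one hx
  exact ⟨j, ε, fun i => by rw [mulVec_single, Complex.ofReal_intCast]⟩

theorem mulVec_mul_mulVec_eq_zero (hG : IsCubic G.u) (hx : x ∈ polygonalSphere N 1) (i k : Fin N)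
    (hik : i ≠ k) : G.mulVec x i * G.mulVec x k = 0 := by
  obtain ⟨j, ε, hj⟩ := G.exists_mulVec_eq_smul hx
  rw [hj, hj, smul_mul_smul_comm, hG.mul_col j hik, smul_zero]

theorem sum_mulVec_mul_self (hG : IsOrthogonal G.u) (hx : x ∈ polygonalSphere N 1) :
    ∑ i, G.mulVec x i * G.mulVec x i = 1 := by
  obtain ⟨j, ε, hj⟩ := G.exists_mulVec_eq_smul hx
  simp only [hj, smul_mul_smul_comm, ← Finset.smul_sum, hG.sum_col, if_true]
  obtain rfl | rfl := Int.units_eq_one_or ε <;> simp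

theorem ActsAffinely.of_eval {X : Set (EuclideanSpace ℝ (Fin N))} [CompactSpace X]
    (φ : X → C(X, ℂ) →⋆ₐ[ℂ] G.A) (hcont : ∀ f, Continuous fun p => φ p f)
    (hφ : ∀ p i, φ p (coordFun X i) = G.mulVec p i) : G.ActsAffinely X := by
  let Φ : C(X, ℂ) →⋆ₐ[ℂ] C(X, G.A) :=
    { toFun := fun f => ⟨fun p => φ p f, hcont f⟩
      map_one' := ContinuousMap.ext fun p => map_one (φ p)
      map_mul' := fun f g => ContinuousMap.ext fun p => map_mul (φ p) f g
      map_zero' := ContinuousMap.ext fun p => map_zero (φ p)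
      map_add' := fun f g => ContinuousMap.ext fun p => map_add (φ p) f g
      commutes' := fun c => ContinuousMap.ext fun p => AlgHomClass.commutes (φ p) c
      map_star' := fun f => ContinuousMap.ext fun p => map_star (φ p) f }
  refine ⟨Φ, fun i => ContinuousMap.ext fun p => (hφ p i).trans ?_⟩
  exact (ContinuousMap.sum_apply Finset.univ (fun j => funTensor (G.u i j) (coordFun X j)) p).symm

end CoordAlgebra

theorem IsCubic.actsAffinely {G : CoordAlgebra.{u} N} (hG : IsCubic G.u) :
    G.ActsAffinely (polygonalSphere N 1) := by
  have he (p : polygonalSphere N 1) := completeOrthogonalIdempotents_spectralProjection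
    (mulVec_mul_mulVec_eq_zero hG p.2) (sum_mulVec_mul_self hG.toIsOrthogonal p.2)
  have hstar (p : polygonalSphere N 1) (a : Fin N × ℤˣ) :=
    star_spectralProjection (star_mulVec hG.toIsOrthogonal p.1 a.1) a.2
  refine .of_eval (fun p => projectionHom vertex (he p) (hstar p)) (fun f => ?_) fun p i =>
    sum_coordFun_vertex_smul_spectralProjection (G.mulVec p) i
  change Continuous fun p : polygonalSphere N 1 =>
    ∑ a, f (vertex a) • spectralProjection (G.mulVec p.1 a.1) a.2
  simp only [spectralProjection, mulVec]
  fun_prop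

/-! ### The quantum isometry groups -/

theorem isQuantumSubgroup_orthogonalGroup (N : ℕ) : (orthogonalGroup N).IsQuantumSubgroup :=
  isQuantumSubgroup_ofMatrices ⟨1, mem_orthogonalMatrices_iff.2 .one⟩ subset_rfl
    (fun _ hU _ hV => mem_orthogonalMatrices_iff.2 <| (mem_orthogonalMatrices_iff.1 hU).mul
      (mem_orthogonalMatrices_iff.1 hV) fun _ _ _ _ => .all _ _)
    fun _ hU => mem_orthogonalMatrices_iff.2 (mem_orthogonalMatrices_iff.1 hU).transpose

theorem isQuantumSubgroup_hyperoctahedralGroup (N : ℕ) :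
    (hyperoctahedralGroup N).IsQuantumSubgroup :=
  isQuantumSubgroup_ofMatrices ⟨1, mem_signedPermutations_iff.2 .one⟩
    signedPermutations_subset_orthogonalMatrices
    (fun _ hU _ hV => mem_signedPermutations_iff.2 <| (mem_signedPermutations_iff.1 hU).mul
      (mem_signedPermutations_iff.1 hV) fun _ _ _ _ => .all _ _)
    fun _ hU => mem_signedPermutations_iff.2 (mem_signedPermutations_iff.1 hU).transpose

theorem isQuantumIsometryGroup_freeHyperoctahedralGroup (N : ℕ) :
    IsQuantumIsometryGroup.{u} (polygonalSphere N 1) (freeHyperoctahedralGroup N) where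
  isQuantumSubgroup := isQuantumSubgroup_freeHyperoctahedralGroup N
  actsAffinely := (isCubic_freeHyperoctahedralGroup N).actsAffinely
  universal _ hH hA := (hH.isCubic hA).exists_lift

theorem isQuantumIsometryGroup_hyperoctahedralGroup {d : ℕ} (hd : 2 ≤ d) (hdN : d < N) :
    IsQuantumIsometryGroup.{u} (polygonalSphere N d) (hyperoctahedralGroup N) where
  isQuantumSubgroup := isQuantumSubgroup_hyperoctahedralGroup N
  actsAffinely := actsAffinely_ofMatrices fun _ => mapsTo_polygonalSphere_of_mem_signedPermutations
  universal _ hH hA := hH.isSubgroupOf_ofMatrices (hH.commute_u hd hA) hA fun _ hU =>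
    hU.mem_signedPermutations_of_mapsTo (one_le_two.trans hd) hdN

theorem isQuantumIsometryGroup_orthogonalGroup (hN : 1 ≤ N) :
    IsQuantumIsometryGroup.{u} (polygonalSphere N N) (orthogonalGroup N) where
  isQuantumSubgroup := isQuantumSubgroup_orthogonalGroup N
  actsAffinely := actsAffinely_ofMatrices fun _ hU =>
    (mem_orthogonalMatrices_iff.1 hU).mapsTo_polygonalSphere_self
  universal H hH hA := by
    have hcomm (i j k l) : Commute (H.u i j) (H.u k l) := by
      obtain rfl | hN := hN.eq_or_lt
      · rw [Subsingleton.elim k i, Subsingleton.elim l j]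
      · exact hH.commute_u hN hA i j k l
    exact hH.isSubgroupOf_ofMatrices hcomm hA fun _ hU _ => mem_orthogonalMatrices_iff.2 hU

end PolygonalSphere

end

theorem proposition3p3 (N d : ℕ) (hd : 1 ≤ d) (hdN : d ≤ N) :
    (d = 1 → PolygonalSphere.CoordAlgebra.IsQuantumIsometryGroup.{u}
      (PolygonalSphere.polygonalSphere N d) (PolygonalSphere.freeHyperoctahedralGroup N)) ∧
    (2 ≤ d ∧ d < N → PolygonalSphere.CoordAlgebra.IsQuantumIsometryGroup.{u}
      (PolygonalSphere.polygonalSphere N d) (PolygonalSphere.hyperoctahedralGroup N)) ∧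
    (d = N → PolygonalSphere.CoordAlgebra.IsQuantumIsometryGroup.{u}
      (PolygonalSphere.polygonalSphere N d) (PolygonalSphere.orthogonalGroup N)) := by
  refine ⟨?_, fun h => ?_, ?_⟩
  · rintro rfl
    exact PolygonalSphere.isQuantumIsometryGroup_freeHyperoctahedralGroup N
  · exact PolygonalSphere.isQuantumIsometryGroup_hyperoctahedralGroup h.1 h.2
  · rintro rfl
    exact PolygonalSphere.isQuantumIsometryGroup_orthogonalGroup hd
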